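/- Let $\mathbb F_q$ be a finite field with $q\equiv 3 \pmod 4$ and let $n\ge 1$ be an odd integer with $\gcd(q,4n)=1$. Let $Q_n=\langle a,b\mid a^{2n}=1,\ b^2=a^n,\ b^{-1}ab=a^{-1}\rangle$ be the generalised quaternion group of order $4n$. For $g\in\mathbb F_q[x]$ with $g(0)\ne 0$ put $g^*(x)=g(0)^{-1}x^{\deg g}g(x^{-1})$. Write $$x^n-1=f_1\cdots f_r\,f_{r+1}f_{r+1}^*\cdots f_{r+s}f_{r+s}^*,\qquad x^n+1=g_1\cdots g_t\,g_{t+1}g_{t+1}^*\cdots g_{t+k}g_{t+k}^*$$ with all factors monic and irreducible over $\mathbb F_q$, where $f_1=x-1$, $g_1=x+1$, $f_i=f_i^*$ for $1\le i\le r$ and $g_j=g_j^*$ for $1\le j\le t$. In a field extension of $\mathbb F_q$ containing all of the following elements, let $\alpha_i$ be any root of $f_i$, $\beta_j$ any root of $g_j$, and $\sqrt{-1}$ any square root of $-1$. Define the blocks $$A_1=\mathbb F_q\oplus\mathbb F_q,\quad A_i=\mathcal M_2(\mathbb F_q(\alpha_i+\alpha_i^{-1}))\ (2\le i\le r),\quad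 A_i=\mathcal M_2(\mathbb F_q(\alpha_i))\ (r<i\le r+s),$$ $$B_1=\mathbb F_q(\sqrt{-1}),\quad B_j=\mathcal M_2(\mathbb F_q(\beta_j+\beta_j^{-1}))\ (2\le j\le t),\quad B_j=\mathcal M_2(\mathbb F_q(\beta_j))\ (t<j\le t+k).$$ For $2\le i\le r$ let $\sigma_i(X)=Z^{-1}XZ$ with $Z=\begin{bmatrix}1&-\alpha_i\\1&-\alpha_i^{-1}\end{bmatrix}$. For $2\le j\le t$ with $4\mid\deg g_j$ let $\gamma_j(X)=Z^{-1}XZ$ with $Z=\begin{bmatrix}\sqrt{-1}&-\beta_j\\ \sqrt{-1}&-\beta_j^{-1}\end{bmatrix}$. For $2\le j\le t$ with $4\nmid\deg g_j$ let $u_j,v_j\in\mathbb F_q(\beta_j+\beta_j^{-1})$ be any elements with $u_j^2+v_j^2=-1$, let $Q=q^{\deg(g_j)/2}$, and let $\theta_j$ be the ring isomorphism from the ring $S_j=\left\{\begin{bmatrix}w&z\\-z^{Q}&w^{Q}\end{bmatrix}: w,z\in\mathbb F_q(\beta_j)\right\}$ onto $\mathcal M_2(\mathbb F_q(\beta_j+\beta_j^{-1}))$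 given, for $x_1,\dots,x_4\in\mathbb F_q(\beta_j+\beta_j^{-1})$, by $$\theta_j:\begin{bmatrix}x_1+x_2\sqrt{-1}&x_3+x_4\sqrt{-1}\\-(x_3-x_4\sqrt{-1})&x_1-x_2\sqrt{-1}\end{bmatrix}\mapsto\begin{bmatrix}x_1+x_2u_j-x_4v_j&x_3+x_2v_j+x_4u_j\\-x_3+x_2v_j+x_4u_j&x_1-x_2u_j+x_4v_j\end{bmatrix}.$$ Let $$\psi:\mathbb F_q[Q_n]\to\bigoplus_{i=1}^{r+s}A_i\oplus\bigoplus_{j=1}^{t+k}B_j$$ be the isomorphism of $\mathbb F_q$-algebras determined by the following images of $a$ and $b$, respectively: - on $A_1$: $(1,1)$ and $(1,-1)$; - on $A_i$, $2\le i\le r$: $\sigma_i\begin{bmatrix}\alpha_i&0\\0&\alpha_i^{-1}\end{bmatrix}$ and $\sigma_i\begin{bmatrix}0&1\\1&0\end{bmatrix}$; - on $A_i$, $r<i\le r+s$: $\begin{bmatrix}\alpha_i&0\\0&\alpha_i^{-1}\end{bmatrix}$ and $\begin{bmatrix}0&1\\1&0\end{bmatrix}$; - on $B_1$: $-1$ and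 $\sqrt{-1}$; - on $B_j$, $2\le j\le t$: $\tau_j\begin{bmatrix}\beta_j&0\\0&\beta_j^{-1}\end{bmatrix}$ and $\tau_j\begin{bmatrix}0&\sqrt{-1}\\ \sqrt{-1}&0\end{bmatrix}$, where $\tau_j=\gamma_j$ if $4\mid\deg g_j$ and $\tau_j=\theta_j$ if $4\nmid\deg g_j$; - on $B_j$, $t<j\le t+k$: $\begin{bmatrix}\beta_j&0\\0&\beta_j^{-1}\end{bmatrix}$ and $\begin{bmatrix}0&-1\\1&0\end{bmatrix}$. Let $\mathcal K\begin{bmatrix}a&b\\c&d\end{bmatrix}=\begin{bmatrix}d&b\\c&a\end{bmatrix}$ and $\mathcal S\begin{bmatrix}a&b\\c&d\end{bmatrix}=\begin{bmatrix}d&-b\\-c&a\end{bmatrix}$, and let $\nu=\bigoplus_i\varphi_i\oplus\bigoplus_j\phi_j$ be the map of $\bigoplus_iA_i\oplus\bigoplus_jB_j$ to itself with $$\varphi_1=\mathrm{id},\qquad \varphi_i=\sigma_i\circ\mathcal K\circ\sigma_i^{-1}\ (2\le i\le r),\qquad \varphi_i=\mathcal K\ (r<i\le r+s),$$ $$\phi_1(x)=x^q,\qquad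 \phi_j=\gamma_j\circ\mathcal S\circ\gamma_j^{-1}\ (2\le j\le t,\ 4\mid\deg g_j),\qquad \phi_j=\theta_j\circ\mathcal S\circ\theta_j^{-1}\ (2\le j\le t,\ 4\nmid\deg g_j),\qquad \phi_j=\mathcal S\ (t<j\le t+k).$$ Then $\theta_j$, $\psi$ and $\nu$ are well defined as described, and $\psi(\hat w)=\nu(\psi(w))$ for all $w\in\mathbb F_q[Q_n]$, where $\hat w=\sum_{g\in Q_n}w_g\,g^{-1}$ for $w=\sum_{g\in Q_n}w_g\,g$. -/

import Mathlib

open Polynomial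
open scoped IntermediateField

noncomputable section

/-- The reciprocal polynomial `g*(x) = g(0)⁻¹ x ^ (deg g) g(x⁻¹)` (for `g(0) ≠ 0`). -/
def recip {F : Type*} [Field F] (g : F[X]) : F[X] :=
  C (g.coeff 0)⁻¹ * g.reverse

/-- `P = f₁ ⋯ f_r · f_{r+1} f_{r+1}* ⋯ f_{r+s} f_{r+s}*` with all `f_i` irreducible and monic,
`f₁ = P₁`, and `f₁, …, f_r` self-reciprocal. Only the values `f 1, …, f (r + s)` matter. -/
structure IsRecipFactorization {F : Type*} [Field F] (P P₁ : F[X]) (r s : ℕ) (f : ℕ → F[X]) :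
    Prop where
  one_le : 1 ≤ r
  first : f 1 = P₁
  irreducible : ∀ i ∈ Finset.Icc 1 (r + s), Irreducible (f i)
  monic : ∀ i ∈ Finset.Icc 1 (r + s), (f i).Monic
  selfRecip : ∀ i ∈ Finset.Icc 1 r, recip (f i) = f i
  prod_eq : P = (∏ i ∈ Finset.Icc 1 r, f i) * ∏ i ∈ Finset.Icc (r + 1) (r + s), f i * recip (f i)

/-- `2 × 2` matrices. -/
abbrev Mat2 (R : Type*) : Type _ := Matrix (Fin 2) (Fin 2) R

/-- The map `x ↦ x̂`, `∑ a_g g ↦ ∑ a_g g⁻¹`, of the group algebra `F[G]`. -/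
def hatMap {F G : Type*} [Field F] [Group G] (x : MonoidAlgebra F G) : MonoidAlgebra F G :=
  MonoidAlgebra.mapDomain (fun g : G => g⁻¹) x

/-- `K : (a b; c d) ↦ (d b; c a)`. -/
def mapK {R : Type*} (X : Mat2 R) : Mat2 R :=
  !![X 1 1, X 0 1; X 1 0, X 0 0]

/-- `S : (a b; c d) ↦ (d -b; -c a)`. -/
def mapS {R : Type*} [Neg R] (X : Mat2 R) : Mat2 R :=
  !![X 1 1, -X 0 1; -X 1 0, X 0 0]

/-- The matrix `diag(x, x⁻¹)`. -/
def diagInv {K : Type*} [Field K] (x : K) : Mat2 K := !![x, 0; 0, x⁻¹]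

/-- The matrix `Z` which defines `σ`, for a root `α`. -/
def sigmaZ {K : Type*} [Field K] (α : K) : Mat2 K := !![1, -α; 1, -α⁻¹]

/-- The matrix `Z` which defines `γ`, for a square root `ι` of `-1` and a root `β`. -/
def gammaZ {K : Type*} [Field K] (ι β : K) : Mat2 K := !![ι, -β; ι, -β⁻¹]

/-- The conjugation `X ↦ Z⁻¹ X Z`. -/
def conjBy {K : Type*} [Field K] (Z X : Mat2 K) : Mat2 K := Z⁻¹ * X * Z

/-- The inverse conjugation `X ↦ Z X Z⁻¹`. -/
def conjByInv {K : Type*} [Field K] (Z X : Mat2 K) : Mat2 K := Z * X * Z⁻¹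

section

variable (F : Type*) [Field F] {L : Type*} [Field L] [Algebra F L]

/-- A matrix over an intermediate field, seen as a matrix over the big field `L`. -/
def toL {F : Type*} [Field F] {L : Type*} [Field L] [Algebra F L] {E : IntermediateField F L}
    (X : Mat2 E) : Mat2 L :=
  X.map (fun x : E => (x : L))

/-- The set `{(w z; -z^(q^d) w^(q^d)) : w, z ∈ F(β)}`, with `q = |F|`. -/
def quatSet [Fintype F] (β : L) (d : ℕ) : Set (Mat2 L) :=
  {M | ∃ w ∈ F⟮β⟯, ∃ z ∈ F⟮β⟯,
    M = !![w, z; -z ^ (Fintype.card F ^ d), w ^ (Fintype.card F ^ d)]}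

/-- The set `quatSet F β d` is a ring, and `iso` is the ring isomorphism `θ` from it onto
`M₂(F(β + β⁻¹))` given by the displayed formula. (Both are determined by `β`, `d`, `ι`, `u`,
`v`.) -/
structure Theta [Fintype F] (ι β : L) (d : ℕ) (u v : F⟮β + β⁻¹⟯) where
  S : Subring (Mat2 L)
  coe_S : (S : Set (Mat2 L)) = quatSet F β d
  iso : S ≃+* Mat2 F⟮β + β⁻¹⟯
  iso_apply : ∀ x₁ x₂ x₃ x₄ : F⟮β + β⁻¹⟯,
    ∃ h : !![(x₁ : L) + x₂ * ι, x₃ + x₄ * ι; -(x₃ - x₄ * ι), x₁ - x₂ * ι] ∈ S,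
      iso ⟨_, h⟩ =
        !![x₁ + x₂ * u - x₄ * v, x₃ + x₂ * v + x₄ * u;
          -x₃ + x₂ * v + x₄ * u, x₁ - x₂ * u + x₄ * v]

/-- `⨁_{i=1}^{r+s} A_i`, grouped as `i = 1`, `2 ≤ i ≤ r`, `r + 1 ≤ i ≤ r + s`. -/
abbrev BlocksA (α : ℕ → L) (r s : ℕ) : Type _ :=
  (F × F) × (∀ i : Set.Icc 2 r, Mat2 F⟮α i + (α i)⁻¹⟯) ×
    (∀ i : Set.Icc (r + 1) (r + s), Mat2 F⟮α i⟯)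

/-- `⨁_{j=1}^{t+k} B_j`, grouped as `j = 1`, `2 ≤ j ≤ t`, `t + 1 ≤ j ≤ t + k`. -/
abbrev BlocksB (ι : L) (β : ℕ → L) (t k : ℕ) : Type _ :=
  F⟮ι⟯ × (∀ j : Set.Icc 2 t, Mat2 F⟮β j + (β j)⁻¹⟯) ×
    (∀ j : Set.Icc (t + 1) (t + k), Mat2 F⟮β j⟯)

/-- The images of a generator of `Q_n` under `ρ_i`, `1 ≤ i ≤ r + s`: on `A₁` the pair `p`, on
`A_i` for `2 ≤ i ≤ r` the matrix `σ_i (M i)`, and on the other blocks the matrix `M i`. -/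
structure HasImageA {F : Type*} [Field F] {L : Type*} [Field L] [Algebra F L]
    {α : ℕ → L} {r s : ℕ} (x : BlocksA F α r s) (p : F × F) (M : ℕ → Mat2 L) : Prop where
  one : x.1 = p
  selfRecip : ∀ i, toL (x.2.1 i) = conjBy (sigmaZ (α i)) (M i)
  rest : ∀ i, toL (x.2.2 i) = M i

/-- The images of a generator of `Q_n` under `η_j`, `1 ≤ j ≤ t + k`: on `B₁` the element `e`, on
`B_j` for `2 ≤ j ≤ t` the matrix `γ_j (M j)` or `θ_j (M j)` according to `4 ∣ deg g_j` or not,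
and on the other blocks the matrix `N j`. -/
structure HasImageB {F : Type*} [Field F] [Fintype F] {L : Type*} [Field L] [Algebra F L]
    {ι : L} {β : ℕ → L} {t k : ℕ} {g : ℕ → F[X]} {u v : ∀ j, F⟮β j + (β j)⁻¹⟯}
    (θ : ∀ j ∈ Set.Icc 2 t, ¬ 4 ∣ (g j).natDegree →
      Theta F ι (β j) ((g j).natDegree / 2) (u j) (v j))
    (x : BlocksB F ι β t k) (e : L) (M N : ℕ → Mat2 L) : Prop where
  one : (x.1 : L) = e
  gamma : ∀ j : Set.Icc 2 t, 4 ∣ (g j).natDegree →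
    toL (x.2.1 j) = conjBy (gammaZ ι (β j)) (M j)
  theta : ∀ (j : Set.Icc 2 t) (h4 : ¬ 4 ∣ (g j).natDegree),
    ∃ h : M j ∈ (θ j j.2 h4).S, x.2.1 j = (θ j j.2 h4).iso ⟨M j, h⟩
  rest : ∀ j, toL (x.2.2 j) = N j

/-- The values of `ψ = ⨁ ρ_i ⊕ ⨁ η_j` on the generators `a` and `b` of `Q_n`. In
`QuaternionGroup n` these are `a 1` and `xa 0`. -/
structure IsPsi {F : Type*} [Field F] [Fintype F] {L : Type*} [Field L] [Algebra F L] {n : ℕ}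
    {ι : L} {α β : ℕ → L} {r s t k : ℕ} {g : ℕ → F[X]} {u v : ∀ j, F⟮β j + (β j)⁻¹⟯}
    (θ : ∀ j ∈ Set.Icc 2 t, ¬ 4 ∣ (g j).natDegree →
      Theta F ι (β j) ((g j).natDegree / 2) (u j) (v j))
    (ψ : MonoidAlgebra F (QuaternionGroup n) ≃ₐ[F] BlocksA F α r s × BlocksB F ι β t k) :
    Prop where
  aA : HasImageA (ψ (MonoidAlgebra.of F _ (QuaternionGroup.a 1))).1 (1, 1)
    (fun i => diagInv (α i))
  bA : HasImageA (ψ (MonoidAlgebra.of F _ (QuaternionGroup.xa 0))).1 (1, -1)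
    (fun _ => !![0, 1; 1, 0])
  aB : HasImageB θ (ψ (MonoidAlgebra.of F _ (QuaternionGroup.a 1))).2 (-1)
    (fun j => diagInv (β j)) (fun j => diagInv (β j))
  bB : HasImageB θ (ψ (MonoidAlgebra.of F _ (QuaternionGroup.xa 0))).2 ι
    (fun _ => !![0, ι; ι, 0]) (fun _ => !![0, -1; 1, 0])

/-- The defining formulas of `φ_i`, `1 ≤ i ≤ r + s`, at a point `x` with value `y`. -/
structure IsVarphi {F : Type*} [Field F] {L : Type*} [Field L] [Algebra F L]
    {α : ℕ → L} {r s : ℕ} (x y : BlocksA F α r s) : Prop where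
  one : y.1 = x.1
  sigma : ∀ i, toL (y.2.1 i) =
    conjBy (sigmaZ (α i)) (mapK (conjByInv (sigmaZ (α i)) (toL (x.2.1 i))))
  rest : ∀ i, y.2.2 i = mapK (x.2.2 i)

/-- The defining formulas of `ϕ_j`, `1 ≤ j ≤ t + k`, at a point `x` with value `y`. -/
structure IsPhi {F : Type*} [Field F] [Fintype F] {L : Type*} [Field L] [Algebra F L]
    {ι : L} {β : ℕ → L} {t k : ℕ} {g : ℕ → F[X]} {u v : ∀ j, F⟮β j + (β j)⁻¹⟯}
    (θ : ∀ j ∈ Set.Icc 2 t, ¬ 4 ∣ (g j).natDegree →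
      Theta F ι (β j) ((g j).natDegree / 2) (u j) (v j))
    (x y : BlocksB F ι β t k) : Prop where
  one : y.1 = x.1 ^ Fintype.card F
  gamma : ∀ j : Set.Icc 2 t, 4 ∣ (g j).natDegree →
    toL (y.2.1 j) =
      conjBy (gammaZ ι (β j)) (mapS (conjByInv (gammaZ ι (β j)) (toL (x.2.1 j))))
  theta : ∀ (j : Set.Icc 2 t) (h4 : ¬ 4 ∣ (g j).natDegree),
    ∃ h : mapS ((θ j j.2 h4).iso.symm (x.2.1 j) : Mat2 L) ∈ (θ j j.2 h4).S,
      y.2.1 j = (θ j j.2 h4).iso ⟨_, h⟩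
  rest : ∀ j, y.2.2 j = mapS (x.2.2 j)

end

end

/-! Over `L` every block other than the two commutative ones is the same kind of representation: `a
↦ diag(x, x⁻¹)` and `b ↦ (0 c; d 0)` with `c * d = x ^ n`, where `x` is a root of `X ^ n - 1` or of
`X ^ n + 1`. The maps `σ`, `γ`, `θ` only rewrite it over the smaller field. For self-reciprocal
factors other than the first, that field is `E = F(x + x⁻¹)`, of degree half that of the factor. As
`q ≡ 3 mod 4`, `√-1` lies in `E` exactly when this half is even. Then conjugation by `Z` suffices;
otherwise the image lies in the quaternion algebra `(-1, -1)` over `E`, which `u ^ 2 + v ^ 2 = -1`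
splits (`range_quatMat`, `nonempty_theta`).

Injectivity of `ψ`: write `w = p(a) + b r(a)` with `p`, `r` of degree less than `2n`. A block kills
`w` only if `p` and `r` vanish at `x` and `x⁻¹` (`quaternionRep_apply`). All blocks together force
vanishing at the `2n` distinct roots of `X ^ (2n) - 1`, hence `p = r = 0`. The target has dimension
at most `4n` (`finrank_blocks`), so `ψ` is bijective.

The hat map: the identity, Frobenius, `mapK` and `mapS` are linear anti-homomorphisms that invert
the images of `a` and `b` in their blocks, so each describes `w ↦ ŵ` there (`algHom_hatMap`). Hence
`ν` can be defined by transporting the hat map along `ψ`. Its formulas hold on the image of `ψ`,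
which is everything, and no separate check that they preserve the smaller fields is needed. -/

noncomputable section

/-! ### The presentation of `Q_n` and the normal form `p(a) + b r(a)`. -/

namespace QuaternionGroup

/-- The homomorphism from `QuaternionGroup n` to a monoid given by its presentation. -/
def liftHom {n : ℕ} [NeZero n] {M : Type*} [Monoid M] (x y : M) (hx : x ^ (2 * n) = 1)
    (hy : y * y = x ^ n) (hxy : x * y * x = y) : QuaternionGroup n →* M :=
  have key (i j : ZMod (2 * n)) : x ^ (i + j).val = x ^ i.val * x ^ j.val := by
    rw [ZMod.val_add, ← pow_add, ← pow_eq_pow_mod _ hx]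
  -- The relation `b⁻¹ab = a⁻¹` is used in the inverse-free form `aba = b`, which makes sense in any
  -- monoid.
  have comm (m : ℕ) : x ^ m * y * x ^ m = y := by
    induction m with
    | zero => simp
    | succ m ih =>
      calc x ^ (m + 1) * y * x ^ (m + 1) = x ^ m * (x * y * x) * x ^ m := by
            rw [pow_succ]; nth_rw 2 [← pow_succ]; rw [pow_succ' x m]; simp only [mul_assoc]
        _ = y := by rw [hxy, ih]
  have swap (i j : ZMod (2 * n)) : x ^ i.val * y * x ^ j.val = y * x ^ (j - i).val := by
    have h : x ^ j.val = x ^ i.val * x ^ (j - i).val := by rw [← key, add_sub_cancel]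
    rw [h, ← mul_assoc, comm]
  have hnval : x ^ (n : ZMod (2 * n)).val = x ^ n := by
    rw [ZMod.val_natCast, ← pow_eq_pow_mod _ hx]
  { toFun := fun g => match g with
      | a i => x ^ i.val
      | xa i => y * x ^ i.val
    map_one' := by
      change x ^ (0 : ZMod (2 * n)).val = 1
      simp
    map_mul' := by
      rintro (i | i) (j | j)
      · simpa using key i j
      · simpa [mul_assoc] using (swap i j).symm
      · simpa [mul_assoc] using congrArg (y * ·) (key i j)
      · have h := swap i j
        simp only [xa_mul_xa, add_sub_assoc, key, hnval, ← hy]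
        rw [mul_assoc y y, ← h]
        simp only [mul_assoc] }

lemma liftHom_a {n : ℕ} [NeZero n] {M : Type*} [Monoid M] (x y : M) (hx : x ^ (2 * n) = 1)
    (hy : y * y = x ^ n) (hxy : x * y * x = y) : liftHom x y hx hy hxy (a 1) = x := by
  change x ^ (1 : ZMod (2 * n)).val = x
  have : Fact (1 < 2 * n) := ⟨by have := NeZero.pos n; omega⟩
  rw [ZMod.val_one, pow_one]

lemma liftHom_xa {n : ℕ} [NeZero n] {M : Type*} [Monoid M] (x y : M) (hx : x ^ (2 * n) = 1)
    (hy : y * y = x ^ n) (hxy : x * y * x = y) : liftHom x y hx hy hxy (xa 0) = y := by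
  change y * x ^ (0 : ZMod (2 * n)).val = y
  simp

lemma a_eq_pow {n : ℕ} [NeZero n] (i : ZMod (2 * n)) : a i = (a 1 : QuaternionGroup n) ^ i.val := by
  simp

lemma xa_eq_mul_pow {n : ℕ} [NeZero n] (i : ZMod (2 * n)) :
    xa i = (xa 0 : QuaternionGroup n) * (a 1) ^ i.val := by
  simp

section GroupAlgebra

variable {F : Type*} [Field F] {n : ℕ} [NeZero n]

/-- `p` in the expression `w = p(a) + b r(a)`. -/
def aPart (w : MonoidAlgebra F (QuaternionGroup n)) : F[X] :=
  ∑ i : ZMod (2 * n), monomial i.val (w.coeff (a i))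

/-- `r` in the expression `w = p(a) + b r(a)`. -/
def xaPart (w : MonoidAlgebra F (QuaternionGroup n)) : F[X] :=
  ∑ i : ZMod (2 * n), monomial i.val (w.coeff (xa i))

lemma degree_sum_monomial_val_lt {m : ℕ} [NeZero m] (c : ZMod m → F) :
    (∑ i : ZMod m, monomial i.val (c i)).degree < m := by
  refine (degree_sum_le _ _).trans_lt ((Finset.sup_lt_iff (WithBot.bot_lt_coe m)).2 fun i _ => ?_)
  exact (degree_monomial_le _ _).trans_lt (Nat.cast_lt.2 i.val_lt)

lemma coeff_sum_monomial_val {m : ℕ} [NeZero m] (c : ZMod m → F) (j : ZMod m) :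
    (∑ i : ZMod m, monomial i.val (c i)).coeff j.val = c j := by
  simp only [finsetSum_coeff, coeff_monomial]
  rw [Finset.sum_eq_single j] <;> simp +contextual [(ZMod.val_injective m).eq_iff]

lemma degree_aPart_lt (w : MonoidAlgebra F (QuaternionGroup n)) :
    (aPart w).degree < (2 * n : ℕ) := degree_sum_monomial_val_lt _

lemma degree_xaPart_lt (w : MonoidAlgebra F (QuaternionGroup n)) :
    (xaPart w).degree < (2 * n : ℕ) := degree_sum_monomial_val_lt _

lemma eq_zero_of_parts_eq_zero {w : MonoidAlgebra F (QuaternionGroup n)} (ha : aPart w = 0)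
    (hb : xaPart w = 0) : w = 0 := by
  ext (i | i)
  · simpa [ha, aPart] using (coeff_sum_monomial_val (fun i => w.coeff (a i)) i).symm.trans
      (congrArg (coeff · i.val) ha)
  · simpa [hb, xaPart] using (coeff_sum_monomial_val (fun i => w.coeff (xa i)) i).symm.trans
      (congrArg (coeff · i.val) hb)

lemma eq_sum_of (w : MonoidAlgebra F (QuaternionGroup n)) :
    w = ∑ i, w.coeff (a i) • MonoidAlgebra.of F _ (a i) +
      ∑ i, w.coeff (xa i) • MonoidAlgebra.of F _ (xa i) := by
  ext (j | j) <;>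
  simp [MonoidAlgebra.coeff_single, Finsupp.single_apply]

/-- This turns questions about kernels of representations into questions about roots of two
polynomials. -/
lemma algHom_apply_eq {A : Type*} [Ring A] [Algebra F A]
    (ρ : MonoidAlgebra F (QuaternionGroup n) →ₐ[F] A) (w : MonoidAlgebra F (QuaternionGroup n)) :
    ρ w = aeval (ρ (.of F _ (a 1))) (aPart w) +
      ρ (.of F _ (xa 0)) * aeval (ρ (.of F _ (a 1))) (xaPart w) := by
  conv_lhs => rw [eq_sum_of w]
  simp only [map_add, map_sum, map_smul, aPart, xaPart, aeval_monomial, Finset.mul_sum]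
  congr 1
  · refine Finset.sum_congr rfl fun i _ => ?_
    have h : MonoidAlgebra.of F _ (a i) = MonoidAlgebra.of F _ (a 1 : QuaternionGroup n) ^ i.val := by
      rw [← map_pow, ← a_eq_pow]
    rw [h, map_pow, Algebra.smul_def]
  · refine Finset.sum_congr rfl fun i _ => ?_
    have h : MonoidAlgebra.of F _ (xa i) = MonoidAlgebra.of F _ (xa 0 : QuaternionGroup n) *
        MonoidAlgebra.of F _ (a 1 : QuaternionGroup n) ^ i.val := by
      rw [← map_pow, ← map_mul, ← xa_eq_mul_pow]
    rw [h, map_mul, map_pow, ← Algebra.smul_def, mul_smul_comm]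

end GroupAlgebra

end QuaternionGroup

/-! ### Finite subfields as fixed fields of powers of Frobenius. -/

section FrobeniusFixed

variable {F : Type*} [Field F] [Fintype F] {L : Type*} [Field L] [Algebra F L]

lemma frobeniusAlgHom_pow_apply (m : ℕ) (x : L) :
    (FiniteField.frobeniusAlgHom F L ^ m) x = x ^ (Fintype.card F ^ m) := by
  rw [AlgHom.coe_pow, FiniteField.coe_frobeniusAlgHom, pow_iterate]

variable (F L) in
/-- The elements `x` of `L` with `x ^ (q ^ m) = x`, where `q = |F|`. -/
def frobeniusFixed (m : ℕ) : IntermediateField F L :=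
  { AlgHom.equalizer (FiniteField.frobeniusAlgHom F L ^ m) (AlgHom.id F L) with
    inv_mem' := fun x hx => by
      have h : (FiniteField.frobeniusAlgHom F L ^ m) x = x := hx
      change (FiniteField.frobeniusAlgHom F L ^ m) x⁻¹ = x⁻¹
      rw [map_inv₀, h] }

lemma mem_frobeniusFixed {m : ℕ} {x : L} :
    x ∈ frobeniusFixed F L m ↔ x ^ (Fintype.card F ^ m) = x := by
  rw [← frobeniusAlgHom_pow_apply]; rfl

lemma card_le_of_pow_eq_self {N : ℕ} (hN : 1 < N) (S : Finset L) (h : ∀ x ∈ S, x ^ N = x) :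
    S.card ≤ N := by
  have := card_le_degree_of_subset_roots (p := (X ^ N - X : L[X])) (Z := S) fun x hx => by
    rw [mem_roots (FiniteField.X_pow_card_sub_X_ne_zero L hN)]
    simp [h x hx]
  rwa [FiniteField.X_pow_card_sub_X_natDegree_eq L hN] at this

lemma one_lt_card_pow {m : ℕ} (hm : 0 < m) : 1 < Fintype.card F ^ m :=
  Nat.one_lt_pow hm.ne' Fintype.one_lt_card

variable (E : IntermediateField F L) [FiniteDimensional F E]

lemma exists_finset_card_eq_pow_finrank :
    ∃ S : Finset L, (∀ x, x ∈ S ↔ x ∈ E) ∧ S.card = Fintype.card F ^ Module.finrank F E := by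
  classical
  have : Finite E := Module.finite_of_finite F
  have := Fintype.ofFinite E
  refine ⟨Finset.univ.map ⟨((↑) : E → L), Subtype.val_injective⟩, fun x => ?_, ?_⟩
  · simp
  · rw [Finset.card_map, Finset.card_univ, Module.card_eq_pow_finrank (K := F)]

lemma pow_card_pow_finrank {x : L} (hx : x ∈ E) :
    x ^ (Fintype.card F ^ Module.finrank F E) = x := by
  have : Finite E := Module.finite_of_finite F
  have := Fintype.ofFinite E
  have h := FiniteField.pow_card (⟨x, hx⟩ : E)
  rw [Module.card_eq_pow_finrank (K := F)] at h
  simpa using congrArg (Subtype.val) h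

/-- With `m = [E : F]`, the `q ^ m` elements of `E` are roots of `X ^ (q ^ m) - X`, which leaves no
room for another root. Membership in `E` thus becomes an equation. -/
lemma mem_iff_pow_card_pow_finrank {x : L} :
    x ∈ E ↔ x ^ (Fintype.card F ^ Module.finrank F E) = x := by
  classical
  refine ⟨pow_card_pow_finrank E, fun h => by_contra fun hx => ?_⟩
  obtain ⟨S, hS, hc⟩ := exists_finset_card_eq_pow_finrank E
  have := card_le_of_pow_eq_self (one_lt_card_pow (F := F) (Module.finrank_pos (M := E)))
    (insert x S) (by
      simp only [Finset.mem_insert, forall_eq_or_imp]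
      exact ⟨h, fun y hy => pow_card_pow_finrank E ((hS y).1 hy)⟩)
  rw [Finset.card_insert_of_notMem (by rwa [hS]), hc] at this
  omega

lemma finrank_le_of_le_frobeniusFixed {m : ℕ} (hm : 0 < m) (h : E ≤ frobeniusFixed F L m) :
    Module.finrank F E ≤ m := by
  obtain ⟨S, hS, hc⟩ := exists_finset_card_eq_pow_finrank E
  have := card_le_of_pow_eq_self (one_lt_card_pow (F := F) hm) S
    fun x hx => mem_frobeniusFixed.1 (h ((hS x).1 hx))
  rw [hc] at this
  exact (Nat.pow_le_pow_iff_right Fintype.one_lt_card).1 this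

end FrobeniusFixed

/-! ### Reciprocal polynomials and inverses of roots. -/

section Reciprocal

variable {F : Type*} [Field F] {L : Type*} [Field L] [Algebra F L]

lemma aeval_reverse_inv_eq_zero_iff {x : L} (hx : x ≠ 0) (p : F[X]) :
    aeval x⁻¹ p.reverse = 0 ↔ aeval x p = 0 := by
  let _ : Invertible x := invertibleOfNonzero hx
  simpa [aeval_def] using eval₂_reverse_eq_zero_iff (algebraMap F L) x p

lemma natDegree_recip {p : F[X]} (hp : p.coeff 0 ≠ 0) : (recip p).natDegree = p.natDegree := by
  rw [recip, natDegree_C_mul (inv_ne_zero hp), reverse_natDegree,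
    natTrailingDegree_eq_zero.2 (Or.inr hp), Nat.sub_zero]

lemma aeval_recip_inv_eq_zero_iff {p : F[X]} (hp : p.coeff 0 ≠ 0) {x : L} (hx : x ≠ 0) :
    aeval x⁻¹ (recip p) = 0 ↔ aeval x p = 0 := by
  rw [recip, map_mul, aeval_C, mul_eq_zero, aeval_reverse_inv_eq_zero_iff hx]
  simp [hp]

end Reciprocal

/-! ### The field `F(x + x⁻¹)` for `x` conjugate to `x⁻¹`. -/

section SelfReciprocal

variable {F : Type*} [Field F] {L : Type*} [Field L] [Algebra F L] {x : L}

/-- Since `x⁻¹` is a conjugate of `x`, some embedding of `F(x)` sends `x` to `x⁻¹`. It fixes `x +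
x⁻¹`, hence all of `F(x + x⁻¹)`, but moves `x`. -/
lemma notMem_adjoin_add_inv (hx : IsIntegral F x) (hinv : aeval x⁻¹ (minpoly F x) = 0)
    (hne : x⁻¹ ≠ x) : x ∉ F⟮x + x⁻¹⟯ := by
  intro hmem
  obtain ⟨τ, hτ⟩ : ∃ τ : F⟮x⟯ →ₐ[F] L, τ (IntermediateField.AdjoinSimple.gen F x) = x⁻¹ :=
    ⟨_, IntermediateField.algHomAdjoinIntegralEquiv_symm_apply_gen F hx
      ⟨x⁻¹, mem_aroots.2 ⟨minpoly.ne_zero hx, hinv⟩⟩⟩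
  have key : ∀ y ∈ F⟮x + x⁻¹⟯, ∃ h : y ∈ F⟮x⟯, τ ⟨y, h⟩ = y := by
    intro y hy
    induction hy using IntermediateField.adjoin_induction with
    | mem y hy =>
      rw [Set.mem_singleton_iff] at hy
      subst hy
      refine ⟨add_mem (IntermediateField.mem_adjoin_simple_self F x)
        (inv_mem (IntermediateField.mem_adjoin_simple_self F x)), ?_⟩
      change τ (IntermediateField.AdjoinSimple.gen F x +
        (IntermediateField.AdjoinSimple.gen F x)⁻¹) = _
      rw [map_add, map_inv₀, hτ, inv_inv, add_comm]
    | algebraMap y => exact ⟨algebraMap_mem _ _, τ.commutes y⟩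
    | add y z _ _ hy hz =>
      obtain ⟨h, hy⟩ := hy
      obtain ⟨h', hz⟩ := hz
      exact ⟨add_mem h h', (map_add τ ⟨y, h⟩ ⟨z, h'⟩).trans (by rw [hy, hz])⟩
    | inv y _ hy =>
      obtain ⟨h, hy⟩ := hy
      exact ⟨inv_mem h, (map_inv₀ τ ⟨y, h⟩).trans (by rw [hy])⟩
    | mul y z _ _ hy hz =>
      obtain ⟨h, hy⟩ := hy
      obtain ⟨h', hz⟩ := hz
      exact ⟨mul_mem h h', (map_mul τ ⟨y, h⟩ ⟨z, h'⟩).trans (by rw [hy, hz])⟩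
  obtain ⟨h, h2⟩ := key x hmem
  exact hne (hτ.symm.trans h2)

lemma adjoin_add_inv_le : F⟮x + x⁻¹⟯ ≤ F⟮x⟯ := by
  rw [IntermediateField.adjoin_simple_le_iff]
  exact add_mem (IntermediateField.mem_adjoin_simple_self F x)
    (inv_mem (IntermediateField.mem_adjoin_simple_self F x))

lemma finiteDimensional_adjoin_add_inv (hx : IsIntegral F x) :
    FiniteDimensional F F⟮x + x⁻¹⟯ :=
  IntermediateField.adjoin.finiteDimensional (hx.add hx.inv)

variable [Fintype F]

lemma frobenius_eq_inv (hx : IsIntegral F x) (hinv : aeval x⁻¹ (minpoly F x) = 0)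
    (hne : x⁻¹ ≠ x) (h0 : x ≠ 0) :
    x ^ (Fintype.card F ^ Module.finrank F F⟮x + x⁻¹⟯) = x⁻¹ := by
  have := finiteDimensional_adjoin_add_inv hx
  have hnot := notMem_adjoin_add_inv hx hinv hne
  rw [mem_iff_pow_card_pow_finrank] at hnot
  have hs := pow_card_pow_finrank F⟮x + x⁻¹⟯ (IntermediateField.mem_adjoin_simple_self F _)
  rw [← frobeniusAlgHom_pow_apply] at hs hnot ⊢
  set φ := FiniteField.frobeniusAlgHom F L ^ Module.finrank F F⟮x + x⁻¹⟯
  rw [map_add, map_inv₀] at hs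
  have hφ : φ x ≠ 0 := by simpa using h0
  -- `φ` fixes `x + x⁻¹`, so `φ x` is a root of `T ^ 2 - (x + x⁻¹) T + 1`. The root `x` is excluded
  -- because `x` is not in the field fixed by `φ`.
  have : (φ x - x) * (φ x - x⁻¹) = 0 := by
    have h1 : φ x * φ x + 1 = (x + x⁻¹) * φ x := by rw [← hs]; field_simp
    have h2 : x * x⁻¹ = 1 := mul_inv_cancel₀ h0
    linear_combination h1 + h2
  rcases mul_eq_zero.1 this with h | h
  · exact absurd (sub_eq_zero.1 h) hnot
  · exact sub_eq_zero.1 h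

lemma finrank_adjoin_eq_two_mul (hx : IsIntegral F x) (hinv : aeval x⁻¹ (minpoly F x) = 0)
    (hne : x⁻¹ ≠ x) (h0 : x ≠ 0) :
    Module.finrank F F⟮x⟯ = 2 * Module.finrank F F⟮x + x⁻¹⟯ := by
  have := finiteDimensional_adjoin_add_inv hx
  have := IntermediateField.adjoin.finiteDimensional hx
  have hpos : 0 < Module.finrank F F⟮x + x⁻¹⟯ := Module.finrank_pos
  have hpos' : 0 < Module.finrank F F⟮x⟯ := Module.finrank_pos
  apply le_antisymm
  -- The Frobenius power that inverts `x` fixes it when applied twice. The other inequality holds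
  -- because the inclusion of fields is proper.
  · refine finrank_le_of_le_frobeniusFixed _ (by omega) ?_
    rw [IntermediateField.adjoin_simple_le_iff, mem_frobeniusFixed, two_mul, pow_add, pow_mul,
      frobenius_eq_inv hx hinv hne h0, inv_pow, frobenius_eq_inv hx hinv hne h0, inv_inv]
  · obtain ⟨c, hc⟩ := IntermediateField.finrank_dvd_of_le_right (adjoin_add_inv_le (F := F) (x := x))
    have hc1 : c ≠ 1 := by
      rintro rfl
      have h := IntermediateField.eq_of_le_of_finrank_eq (adjoin_add_inv_le (F := F) (x := x))
        (by rw [hc, mul_one])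
      exact notMem_adjoin_add_inv hx hinv hne (h ▸ IntermediateField.mem_adjoin_simple_self F x)
    have hc0 : c ≠ 0 := by rintro rfl; omega
    rw [hc, mul_comm]
    exact Nat.mul_le_mul_left _ (by omega)

end SelfReciprocal

/-! ### Homomorphisms out of the group algebra and the hat map. -/

section GroupAlgebraMaps

open QuaternionGroup

variable {F : Type*} [Field F] {n : ℕ} [NeZero n] {A : Type*} [Ring A] [Algebra F A]

lemma quaternionAlgebra_algHom_ext {ρ₁ ρ₂ : MonoidAlgebra F (QuaternionGroup n) →ₐ[F] A}
    (ha : ρ₁ (.of F _ (a 1)) = ρ₂ (.of F _ (a 1)))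
    (hb : ρ₁ (.of F _ (xa 0)) = ρ₂ (.of F _ (xa 0))) : ρ₁ = ρ₂ := by
  ext w
  rw [algHom_apply_eq, algHom_apply_eq ρ₂, ha, hb]

/-- The homomorphism from the group algebra of `QuaternionGroup n` with given values at the
generators. -/
def quaternionAlgebraLift (x y : A) (hx : x ^ (2 * n) = 1)
    (hy : y * y = x ^ n) (hxy : x * y * x = y) :
    MonoidAlgebra F (QuaternionGroup n) →ₐ[F] A :=
  MonoidAlgebra.lift F A _ (liftHom x y hx hy hxy)

lemma quaternionAlgebraLift_a (x y : A) (hx : x ^ (2 * n) = 1)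
    (hy : y * y = x ^ n) (hxy : x * y * x = y) :
    quaternionAlgebraLift (F := F) x y hx hy hxy (.of F _ (a 1)) = x := by
  rw [quaternionAlgebraLift, MonoidAlgebra.lift_of, liftHom_a]

lemma quaternionAlgebraLift_xa (x y : A) (hx : x ^ (2 * n) = 1)
    (hy : y * y = x ^ n) (hxy : x * y * x = y) :
    quaternionAlgebraLift (F := F) x y hx hy hxy (.of F _ (xa 0)) = y := by
  rw [quaternionAlgebraLift, MonoidAlgebra.lift_of, liftHom_xa]

/-- A representation of `QuaternionGroup n` factors through every injective algebra homomorphism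
whose image contains the images of the generators. -/
lemma exists_algHom_factor {M : Type*} [Ring M] [Algebra F M]
    (ρ : MonoidAlgebra F (QuaternionGroup n) →ₐ[F] M) (e : A →ₐ[F] M)
    (he : Function.Injective e) (x y : A) (hx : e x = ρ (.of F _ (a 1)))
    (hy : e y = ρ (.of F _ (xa 0))) :
    ∃ ρ' : MonoidAlgebra F (QuaternionGroup n) →ₐ[F] A,
      ρ' (.of F _ (a 1)) = x ∧ ρ' (.of F _ (xa 0)) = y ∧ ∀ w, e (ρ' w) = ρ w := by
  have h1 : x ^ (2 * n) = 1 := he (by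
    rw [map_pow, hx, ← map_pow, ← map_pow, a_one_pow_n, map_one, map_one, map_one])
  have h2 : y * y = x ^ n := he (by
    rw [map_pow, map_mul, hx, hy, ← map_mul, ← map_mul, ← map_pow, ← map_pow, ← sq, xa_sq,
      a_one_pow])
  have h3 : x * y * x = y := he (by
    simp only [map_mul, hx, hy]
    simp only [← map_mul]
    simp)
  refine ⟨quaternionAlgebraLift x y h1 h2 h3, quaternionAlgebraLift_a ..,
    quaternionAlgebraLift_xa .., fun w => ?_⟩
  have : e.comp (quaternionAlgebraLift x y h1 h2 h3) = ρ := quaternionAlgebra_algHom_ext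
    (by rw [AlgHom.comp_apply, quaternionAlgebraLift_a, hx])
    (by rw [AlgHom.comp_apply, quaternionAlgebraLift_xa, hy])
  exact DFunLike.congr_fun this w

/-- A linear anti-homomorphism that inverts the images of the generators describes the map
`hatMap`. -/
lemma algHom_hatMap (ρ : MonoidAlgebra F (QuaternionGroup n) →ₐ[F] A) (κ : A →ₗ[F] A)
    (h1 : κ 1 = 1) (hmul : ∀ X Y, κ (X * Y) = κ Y * κ X)
    (ha : κ (ρ (.of F _ (a 1))) * ρ (.of F _ (a 1)) = 1)
    (hb : κ (ρ (.of F _ (xa 0))) * ρ (.of F _ (xa 0)) = 1)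
    (w : MonoidAlgebra F (QuaternionGroup n)) : ρ (hatMap w) = κ (ρ w) := by
  have gen : ∀ g : QuaternionGroup n, κ (ρ (.of F _ g)) * ρ (.of F _ g) = 1 →
      ρ (.of F _ g⁻¹) = κ (ρ (.of F _ g)) := by
    intro g hg
    calc ρ (.of F _ g⁻¹) = κ (ρ (.of F _ g)) * ρ (.of F _ g) * ρ (.of F _ g⁻¹) := by
          rw [hg, one_mul]
      _ = κ (ρ (.of F _ g)) := by
          rw [mul_assoc, ← map_mul, ← map_mul, mul_inv_cancel, map_one, map_one, mul_one]
  have mul : ∀ g h : QuaternionGroup n, ρ (.of F _ g⁻¹) = κ (ρ (.of F _ g)) →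
      ρ (.of F _ h⁻¹) = κ (ρ (.of F _ h)) →
      ρ (.of F _ (g * h)⁻¹) = κ (ρ (.of F _ (g * h))) := by
    intro g h hg hh
    rw [mul_inv_rev, map_mul, map_mul, hg, hh, map_mul, map_mul, hmul]
  have pow : ∀ k : ℕ, ρ (.of F _ ((a 1 : QuaternionGroup n) ^ k)⁻¹) =
      κ (ρ (.of F _ ((a 1 : QuaternionGroup n) ^ k))) := by
    intro k
    induction k with
    | zero => simp only [pow_zero, inv_one, map_one, h1]
    | succ k ih => rw [pow_succ]; exact mul _ _ ih (gen _ ha)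
  have all : ∀ g : QuaternionGroup n, ρ (.of F _ g⁻¹) = κ (ρ (.of F _ g)) := by
    rintro (i | i)
    · rw [a_eq_pow]; exact pow _
    · rw [xa_eq_mul_pow]; exact mul _ _ (gen _ hb) (pow _)
  have hadd (w₁ w₂ : MonoidAlgebra F (QuaternionGroup n)) :
      hatMap (w₁ + w₂) = hatMap w₁ + hatMap w₂ := MonoidAlgebra.mapDomain_add ..
  have hhat : hatMap w = ∑ i, w.coeff (a i) • MonoidAlgebra.of F _ (a i)⁻¹ +
      ∑ i, w.coeff (xa i) • MonoidAlgebra.of F _ (xa i)⁻¹ := by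
    conv_lhs => rw [eq_sum_of w]
    change AddMonoidHom.mk' (hatMap : MonoidAlgebra F (QuaternionGroup n) → _) hadd _ = _
    simp only [map_add, map_sum]
    simp [hatMap]
  conv_rhs => rw [eq_sum_of w]
  rw [hhat]
  simp only [map_add, map_sum, map_smul, all]

end GroupAlgebraMaps

/-! ### Two-by-two matrices: the anti-automorphisms and conjugation. -/

section Mat2

variable {F : Type*} [Field F] {K : Type*} [Field K] [Algebra F K]

variable (F K) in
/-- `mapK` as a linear map. -/
def mapKLinear : Mat2 K →ₗ[F] Mat2 K where
  toFun := mapK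
  map_add' X Y := by ext i j; fin_cases i <;> fin_cases j <;> simp [mapK]
  map_smul' c X := by ext i j; fin_cases i <;> fin_cases j <;> simp [mapK]

variable (F K) in
/-- `mapS` as a linear map. -/
def mapSLinear : Mat2 K →ₗ[F] Mat2 K where
  toFun := mapS
  map_add' X Y := by ext i j; fin_cases i <;> fin_cases j <;> simp [mapS, add_comm]
  map_smul' c X := by ext i j; fin_cases i <;> fin_cases j <;> simp [mapS]

lemma mapK_one : mapK (1 : Mat2 K) = 1 := by
  ext i j; fin_cases i <;> fin_cases j <;> simp [mapK]

lemma mapS_one : mapS (1 : Mat2 K) = 1 := by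
  ext i j; fin_cases i <;> fin_cases j <;> simp [mapS]

/-- `mapK` is the transpose conjugated by the swap matrix `(0 1; 1 0)`. -/
lemma mapK_mul (X Y : Mat2 K) : mapK (X * Y) = mapK Y * mapK X := by
  ext i j; fin_cases i <;> fin_cases j <;> simp [mapK, Matrix.mul_apply, Fin.sum_univ_two] <;> ring

/-- `mapS` is the adjugate; it inverts matrices of determinant one. -/
lemma mapS_mul (X Y : Mat2 K) : mapS (X * Y) = mapS Y * mapS X := by
  ext i j; fin_cases i <;> fin_cases j <;> simp [mapS, Matrix.mul_apply, Fin.sum_univ_two] <;> ring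

/-- `conjByInv` as an algebra homomorphism. -/
def conjByInvHom (F : Type*) [Field F] [Algebra F K] (Z : Mat2 K) (hZ : IsUnit Z.det) :
    Mat2 K →ₐ[F] Mat2 K where
  toFun := conjByInv Z
  map_one' := by rw [conjByInv, mul_one, Matrix.mul_nonsing_inv _ hZ]
  map_mul' X Y := by
    simp only [conjByInv, mul_assoc]
    rw [← mul_assoc Z⁻¹ Z, Matrix.nonsing_inv_mul _ hZ, one_mul]
  map_zero' := by simp [conjByInv]
  map_add' X Y := by simp only [conjByInv, mul_add, add_mul]
  commutes' c := by
    simp only [conjByInv]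
    rw [← Algebra.commutes, mul_assoc, Matrix.mul_nonsing_inv _ hZ, mul_one]

lemma conjBy_conjByInv {Z : Mat2 K} (hZ : IsUnit Z.det) (X : Mat2 K) :
    conjBy Z (conjByInv Z X) = X := by
  simp only [conjBy, conjByInv, mul_assoc]
  rw [Matrix.nonsing_inv_mul _ hZ, mul_one, ← mul_assoc, Matrix.nonsing_inv_mul _ hZ, one_mul]

lemma conjByInv_conjBy {Z : Mat2 K} (hZ : IsUnit Z.det) (X : Mat2 K) :
    conjByInv Z (conjBy Z X) = X := by
  simp only [conjBy, conjByInv, mul_assoc]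
  rw [Matrix.mul_nonsing_inv _ hZ, mul_one, ← mul_assoc, Matrix.mul_nonsing_inv _ hZ, one_mul]

lemma conjBy_eq_iff {Z : Mat2 K} (hZ : IsUnit Z.det) {X Y : Mat2 K} :
    conjBy Z X = Y ↔ X * Z = Z * Y := by
  rw [conjBy, mul_assoc]
  constructor
  · rintro rfl
    rw [← mul_assoc, Matrix.mul_nonsing_inv _ hZ, one_mul]
  · intro h
    rw [h, ← mul_assoc, Matrix.nonsing_inv_mul _ hZ, one_mul]

/-- `toL` as an algebra homomorphism. -/
def toLHom (E : IntermediateField F K) : Mat2 E →ₐ[F] Mat2 K := E.val.mapMatrix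

lemma toLHom_apply (E : IntermediateField F K) (X : Mat2 E) : toLHom E X = toL X := rfl

lemma toL_injective (E : IntermediateField F K) :
    Function.Injective (toL : Mat2 E → Mat2 K) :=
  Matrix.map_injective Subtype.val_injective

lemma toL_mapK {E : IntermediateField F K} (X : Mat2 E) : toL (mapK X) = mapK (toL X) := by
  ext i j; fin_cases i <;> fin_cases j <;> simp [mapK, toL]

lemma toL_mapS {E : IntermediateField F K} (X : Mat2 E) : toL (mapS X) = mapS (toL X) := by
  ext i j; fin_cases i <;> fin_cases j <;> simp [mapS, toL]

lemma aeval_diagInv (x : K) (p : F[X]) :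
    aeval (diagInv x) p = !![aeval x p, 0; 0, aeval x⁻¹ p] := by
  induction p using Polynomial.induction_on' with
  | add p q hp hq =>
    rw [map_add, hp, hq]
    ext i j; fin_cases i <;> fin_cases j <;> simp
  | monomial m c =>
    have h : diagInv x ^ m = !![x ^ m, 0; 0, x⁻¹ ^ m] := by
      induction m with
      | zero => ext i j; fin_cases i <;> fin_cases j <;> simp
      | succ m ih => rw [pow_succ, ih, diagInv]; simp [pow_succ]
    simp only [aeval_monomial, h, ← Algebra.smul_def]
    ext i j; fin_cases i <;> fin_cases j <;> simp

end Mat2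

/-! ### The diagonal and antidiagonal representations of `Q_n`. -/

section QuaternionRep

open QuaternionGroup

variable {F : Type*} [Field F] {K : Type*} [Field K] [Algebra F K] {n : ℕ} [NeZero n]

lemma diagInv_pow (x : K) (m : ℕ) : diagInv x ^ m = !![x ^ m, 0; 0, x⁻¹ ^ m] := by
  simpa using aeval_diagInv (F := K) x (X ^ m)

/-- `a ↦ diag(x, x⁻¹)`, `b ↦ (0 c; d 0)`. -/
lemma exists_quaternionRep {x c d : K} (hcd : c * d = x ^ n) (hx : (x ^ n) ^ 2 = 1) :
    ∃ ρ : MonoidAlgebra F (QuaternionGroup n) →ₐ[F] Mat2 K,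
      ρ (.of F _ (a 1)) = diagInv x ∧ ρ (.of F _ (xa 0)) = !![0, c; d, 0] := by
  have hx0 : x ≠ 0 := by
    rintro rfl
    simp [NeZero.ne n] at hx
  -- Hence `diag(x, x⁻¹) ^ n` is scalar, so `b ^ 2 = a ^ n` reduces to `c * d = x ^ n`.
  have hinv : x⁻¹ ^ n = x ^ n := by
    rw [inv_pow]
    exact inv_eq_of_mul_eq_one_left (by rw [← sq, hx])
  refine ⟨quaternionAlgebraLift (diagInv x) !![0, c; d, 0] ?_ ?_ ?_,
    quaternionAlgebraLift_a .., quaternionAlgebraLift_xa ..⟩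
  · rw [mul_comm, pow_mul, diagInv_pow, hinv, Matrix.one_fin_two]
    simp [pow_two, ← hx]
  · rw [diagInv_pow, hinv]
    simp [hcd, mul_comm d c]
  · simp [diagInv]
    constructor
    · field_simp
    · field_simp

lemma quaternionRep_apply {x c d : K} {ρ : MonoidAlgebra F (QuaternionGroup n) →ₐ[F] Mat2 K}
    (ha : ρ (.of F _ (a 1)) = diagInv x) (hb : ρ (.of F _ (xa 0)) = !![0, c; d, 0])
    (w : MonoidAlgebra F (QuaternionGroup n)) :
    ρ w = !![aeval x (aPart w), c * aeval x⁻¹ (xaPart w);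
      d * aeval x (xaPart w), aeval x⁻¹ (aPart w)] := by
  rw [algHom_apply_eq, ha, hb, aeval_diagInv, aeval_diagInv]
  simp

lemma aeval_parts_eq_zero_of_quaternionRep_eq_zero {x c d : K}
    {ρ : MonoidAlgebra F (QuaternionGroup n) →ₐ[F] Mat2 K}
    (ha : ρ (.of F _ (a 1)) = diagInv x) (hb : ρ (.of F _ (xa 0)) = !![0, c; d, 0])
    (hc : c ≠ 0) (hd : d ≠ 0) {w : MonoidAlgebra F (QuaternionGroup n)} (h : ρ w = 0) :
    (aeval x (aPart w) = 0 ∧ aeval x⁻¹ (aPart w) = 0) ∧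
      (aeval x (xaPart w) = 0 ∧ aeval x⁻¹ (xaPart w) = 0) := by
  rw [quaternionRep_apply ha hb] at h
  have h00 := congrFun (congrFun h 0) 0
  have h01 := congrFun (congrFun h 0) 1
  have h10 := congrFun (congrFun h 1) 0
  have h11 := congrFun (congrFun h 1) 1
  simp_all

/-- Here `b` has determinant `-1`, so the adjugate would give `-b⁻¹`. `mapK` leaves antidiagonal
entries alone, and the swap matrix is its own inverse. -/
lemma quaternionRep_hatMap_mapK {x : K} {ρ : MonoidAlgebra F (QuaternionGroup n) →ₐ[F] Mat2 K}
    (ha : ρ (.of F _ (a 1)) = diagInv x) (hb : ρ (.of F _ (xa 0)) = !![0, 1; 1, 0])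
    (hx : x ≠ 0) (w : MonoidAlgebra F (QuaternionGroup n)) :
    ρ (hatMap w) = mapK (ρ w) := by
  refine algHom_hatMap ρ (mapKLinear F K) mapK_one mapK_mul ?_ ?_ w
  · rw [ha]
    change mapK _ * _ = _
    simp [mapK, diagInv, hx, Matrix.one_fin_two]
  · rw [hb]
    change mapK _ * _ = _
    simp [mapK, Matrix.one_fin_two]

/-- As `c * d = -1`, the images of `a` and `b` both have determinant one, and the adjugate inverts
them. -/
lemma quaternionRep_hatMap_mapS {x c d : K}
    {ρ : MonoidAlgebra F (QuaternionGroup n) →ₐ[F] Mat2 K}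
    (ha : ρ (.of F _ (a 1)) = diagInv x) (hb : ρ (.of F _ (xa 0)) = !![0, c; d, 0])
    (hx : x ≠ 0) (hcd : c * d = -1) (w : MonoidAlgebra F (QuaternionGroup n)) :
    ρ (hatMap w) = mapS (ρ w) := by
  refine algHom_hatMap ρ (mapSLinear F K) mapS_one mapS_mul ?_ ?_ w
  · rw [ha]
    change mapS _ * _ = _
    simp [mapS, diagInv, hx, Matrix.one_fin_two]
  · rw [hb]
    change mapS _ * _ = _
    simp [mapS, Matrix.one_fin_two, hcd, mul_comm d c]

end QuaternionRep

/-! ### Frobenius on a square root of `-1`. -/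

section Iota

/-- The parity of `m` decides whether `ι` lies in a field of `q ^ m` elements; this separates the
`γ` blocks from the `θ` blocks. -/
lemma iota_pow_card_pow {L : Type*} [Field L] {ι : L} (hι : ι ^ 2 = -1) {q : ℕ} (hq : q % 4 = 3)
    (m : ℕ) : ι ^ q ^ m = (-1) ^ m * ι := by
  have h1 : ι ^ q = -ι := by
    conv_lhs => rw [← Nat.div_add_mod q 4, hq, pow_add, pow_mul]
    linear_combination (((ι ^ 4) ^ (q / 4) * ι)) * hι - ι * ((by
      rw [show ι ^ 4 = (ι ^ 2) ^ 2 by ring, hι]; simp : (ι ^ 4) ^ (q / 4) = 1))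
  induction m with
  | zero => simp
  | succ m ih =>
    have hodd : Odd q := Nat.odd_iff.2 (by omega)
    rw [pow_succ, pow_mul, ih, mul_pow, h1, ← pow_mul, mul_comm m q, pow_mul, hodd.neg_one_pow,
      pow_succ]
    ring

end Iota

/-! ### The quaternion algebra `(-1, -1)` and its splitting. -/

section QuatSplit

variable {K : Type*} [Field K]

/-- The matrix `(x₁ + x₂ ι, x₃ + x₄ ι; -(x₃ - x₄ ι), x₁ - x₂ ι)`. -/
def quatMat (ι x₁ x₂ x₃ x₄ : K) : Mat2 K :=
  !![x₁ + x₂ * ι, x₃ + x₄ * ι; -(x₃ - x₄ * ι), x₁ - x₂ * ι]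

/-- The matrix that corresponds to `quatMat ι x₁ x₂ x₃ x₄` if `u ^ 2 + v ^ 2 = -1`. -/
def splitMat (u v x₁ x₂ x₃ x₄ : K) : Mat2 K :=
  !![x₁ + x₂ * u - x₄ * v, x₃ + x₂ * v + x₄ * u; -x₃ + x₂ * v + x₄ * u, x₁ - x₂ * u + x₄ * v]

/-- The map `splitMat ↦ quatMat` as a function of the matrix entries. -/
def splitToQuat (ι u v : K) (N : Mat2 K) : Mat2 K :=
  -- The half-difference `x₂ u - x₄ v` and half-sum `x₂ v + x₄ u` are solved for `x₂` and `x₄`; the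
  -- determinant of this system is `u ^ 2 + v ^ 2 = -1`.
  quatMat ι ((N 0 0 + N 1 1) / 2)
    (-((N 0 0 - N 1 1) / 2 * u + (N 0 1 + N 1 0) / 2 * v)) ((N 0 1 - N 1 0) / 2)
    ((N 0 0 - N 1 1) / 2 * v - (N 0 1 + N 1 0) / 2 * u)

lemma splitToQuat_splitMat (h2 : (2 : K) ≠ 0) (ι : K) {u v : K} (huv : u ^ 2 + v ^ 2 = -1)
    (x₁ x₂ x₃ x₄ : K) :
    splitToQuat ι u v (splitMat u v x₁ x₂ x₃ x₄) = quatMat ι x₁ x₂ x₃ x₄ := by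
  rw [splitToQuat]
  congr 1
  · simp [splitMat]; field_simp; ring
  · simp [splitMat]; field_simp; linear_combination (-2 * x₂) * huv
  · simp [splitMat]; field_simp; ring
  · simp [splitMat]; field_simp; linear_combination (-2 * x₄) * huv

lemma splitMat_surjective (h2 : (2 : K) ≠ 0) {u v : K} (huv : u ^ 2 + v ^ 2 = -1) (N : Mat2 K) :
    ∃ x₁ x₂ x₃ x₄, N = splitMat u v x₁ x₂ x₃ x₄ := by
  refine ⟨(N 0 0 + N 1 1) / 2,
    -((N 0 0 - N 1 1) / 2 * u + (N 0 1 + N 1 0) / 2 * v), (N 0 1 - N 1 0) / 2,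
    (N 0 0 - N 1 1) / 2 * v - (N 0 1 + N 1 0) / 2 * u, ?_⟩
  ext i j
  fin_cases i <;> fin_cases j <;> simp [splitMat] <;> field_simp
  · linear_combination (N 0 0 - N 1 1) * huv
  · linear_combination (N 0 1 + N 1 0) * huv
  · linear_combination (N 0 1 + N 1 0) * huv
  · linear_combination (N 1 1 - N 0 0) * huv

/-- The right-hand coordinates are Hamilton's product for the basis `1, i, j, k`. `quatMat_mul` has
the same ones, so passing from one matrix form to the other is multiplicative. -/
lemma splitMat_mul {u v : K} (huv : u ^ 2 + v ^ 2 = -1) (x₁ x₂ x₃ x₄ y₁ y₂ y₃ y₄ : K) :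
    splitMat u v x₁ x₂ x₃ x₄ * splitMat u v y₁ y₂ y₃ y₄ = splitMat u v
      (x₁ * y₁ - x₂ * y₂ - x₃ * y₃ - x₄ * y₄) (x₁ * y₂ + x₂ * y₁ + x₃ * y₄ - x₄ * y₃)
      (x₁ * y₃ - x₂ * y₄ + x₃ * y₁ + x₄ * y₂) (x₁ * y₄ + x₂ * y₃ - x₃ * y₂ + x₄ * y₁) := by
  ext i j
  fin_cases i <;> fin_cases j <;> simp [splitMat, Matrix.mul_apply, Fin.sum_univ_two]
  · linear_combination (x₂ * y₂ + x₄ * y₄) * huv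
  · linear_combination (x₂ * y₄ - x₄ * y₂) * huv
  · linear_combination (x₄ * y₂ - x₂ * y₄) * huv
  · linear_combination (x₂ * y₂ + x₄ * y₄) * huv

lemma quatMat_mul {ι : K} (hι : ι ^ 2 = -1) (x₁ x₂ x₃ x₄ y₁ y₂ y₃ y₄ : K) :
    quatMat ι x₁ x₂ x₃ x₄ * quatMat ι y₁ y₂ y₃ y₄ = quatMat ι
      (x₁ * y₁ - x₂ * y₂ - x₃ * y₃ - x₄ * y₄) (x₁ * y₂ + x₂ * y₁ + x₃ * y₄ - x₄ * y₃)
      (x₁ * y₃ - x₂ * y₄ + x₃ * y₁ + x₄ * y₂) (x₁ * y₄ + x₂ * y₃ - x₃ * y₂ + x₄ * y₁) := by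
  ext i j
  fin_cases i <;> fin_cases j <;> simp [quatMat, Matrix.mul_apply, Fin.sum_univ_two]
  · linear_combination (x₂ * y₂ + x₄ * y₄) * hι
  · linear_combination (x₂ * y₄ - x₄ * y₂) * hι
  · linear_combination (x₄ * y₂ - x₂ * y₄) * hι
  · linear_combination (x₂ * y₂ + x₄ * y₄) * hι

lemma eq_zero_of_quatMat_eq_zero {ι : K} (hι : ι ^ 2 = -1) (h2 : (2 : K) ≠ 0) {x₁ x₂ x₃ x₄ : K}
    (h : quatMat ι x₁ x₂ x₃ x₄ = 0) : x₁ = 0 ∧ x₂ = 0 ∧ x₃ = 0 ∧ x₄ = 0 := by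
  have h00 : x₁ + x₂ * ι = 0 := congrFun (congrFun h 0) 0
  have h01 : x₃ + x₄ * ι = 0 := congrFun (congrFun h 0) 1
  have h10 : -(x₃ - x₄ * ι) = 0 := congrFun (congrFun h 1) 0
  have h11 : x₁ - x₂ * ι = 0 := congrFun (congrFun h 1) 1
  refine ⟨?_, ?_, ?_, ?_⟩ <;> refine (mul_eq_zero_iff_left h2).1 ?_
  · linear_combination h00 + h11
  · linear_combination -ι * (h00 - h11) + 2 * x₂ * hι
  · linear_combination h01 - h10
  · linear_combination -ι * (h01 + h10) + 2 * x₄ * hι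

/-- `splitToQuat` as a ring homomorphism. -/
def splitToQuatHom {ι : K} (hι : ι ^ 2 = -1) (h2 : (2 : K) ≠ 0) {u v : K}
    (huv : u ^ 2 + v ^ 2 = -1) : Mat2 K →+* Mat2 K where
  toFun := splitToQuat ι u v
  map_zero' := by
    ext i j
    fin_cases i <;> fin_cases j <;> simp [splitToQuat, quatMat]
  map_add' X Y := by
    ext i j
    fin_cases i <;> fin_cases j <;> simp [splitToQuat, quatMat] <;> ring
  map_one' := by
    have h : splitMat u v 1 0 0 0 = 1 := by simp [splitMat, Matrix.one_fin_two]
    rw [← h, splitToQuat_splitMat h2 ι huv, h]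
    simp [quatMat, Matrix.one_fin_two]
  map_mul' X Y := by
    obtain ⟨x₁, x₂, x₃, x₄, rfl⟩ := splitMat_surjective h2 huv X
    obtain ⟨y₁, y₂, y₃, y₄, rfl⟩ := splitMat_surjective h2 huv Y
    simp only [splitMat_mul huv, splitToQuat_splitMat h2 ι huv, quatMat_mul hι]

lemma splitToQuatHom_injective {ι : K} (hι : ι ^ 2 = -1) (h2 : (2 : K) ≠ 0) {u v : K}
    (huv : u ^ 2 + v ^ 2 = -1) : Function.Injective (splitToQuatHom hι h2 huv) := by
  rw [injective_iff_map_eq_zero]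
  intro N hN
  obtain ⟨x₁, x₂, x₃, x₄, rfl⟩ := splitMat_surjective h2 huv N
  have h : quatMat ι x₁ x₂ x₃ x₄ = 0 := (splitToQuat_splitMat h2 ι huv _ _ _ _).symm.trans hN
  obtain ⟨rfl, rfl, rfl, rfl⟩ := eq_zero_of_quatMat_eq_zero hι h2 h
  ext i j
  fin_cases i <;> fin_cases j <;> simp [splitMat]

end QuatSplit

/-! ### The ring `S` and the isomorphism `θ`. -/

section Theta

variable {F : Type*} [Field F] {L : Type*} [Field L] [Algebra F L]

lemma toL_splitMat {E : IntermediateField F L} (u v x₁ x₂ x₃ x₄ : E) :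
    toL (splitMat u v x₁ x₂ x₃ x₄) = splitMat (u : L) v x₁ x₂ x₃ x₄ := by
  ext i j
  fin_cases i <;> fin_cases j <;> simp [toL, splitMat]

variable [Fintype F]

/-- The power map in `quatSet` is the nontrivial automorphism of `F(β)` over `E = F(β + β⁻¹)`. As
the degree of `E` is odd, it sends `ι` to `-ι`, and `F(β) = E ⊕ E ι`. -/
lemma range_quatMat {ι β : L} (hι : ι ^ 2 = -1) (h2 : (2 : L) ≠ 0)
    (hq : Fintype.card F % 4 = 3) (hβ : IsIntegral F β) (hβ0 : β ≠ 0)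
    (hinv : aeval β⁻¹ (minpoly F β) = 0) (hne : β⁻¹ ≠ β)
    (hodd : Odd (Module.finrank F F⟮β + β⁻¹⟯)) (M : Mat2 L) :
    M ∈ quatSet F β (Module.finrank F F⟮β + β⁻¹⟯) ↔
      ∃ x₁ x₂ x₃ x₄ : F⟮β + β⁻¹⟯, M = quatMat ι (x₁ : L) x₂ x₃ x₄ := by
  have := finiteDimensional_adjoin_add_inv hβ
  have := IntermediateField.adjoin.finiteDimensional hβ
  have hfr := finrank_adjoin_eq_two_mul hβ hinv hne hβ0
  set d := Module.finrank F F⟮β + β⁻¹⟯ with hd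
  have hι0 : ι ≠ 0 := by rintro rfl; simp at hι
  have hιβ : ι ∈ F⟮β⟯ := by
    rw [mem_iff_pow_card_pow_finrank, hfr, iota_pow_card_pow hι hq, pow_mul]; simp
  have hιd : ι ^ Fintype.card F ^ d = -ι := by
    rw [iota_pow_card_pow hι hq, hodd.neg_one_pow]; ring
  have hle : F⟮β + β⁻¹⟯ ≤ F⟮β⟯ := adjoin_add_inv_le
  obtain ⟨φ, hφ⟩ : ∃ φ : L →ₐ[F] L, ∀ x, φ x = x ^ Fintype.card F ^ d :=
    ⟨_, frobeniusAlgHom_pow_apply d⟩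
  have hE (x : F⟮β + β⁻¹⟯) : φ x = x := by rw [hφ, pow_card_pow_finrank _ x.2]
  have hφι : φ ι = -ι := by rw [hφ, hιd]
  have split : ∀ w ∈ F⟮β⟯, ∃ x y : F⟮β + β⁻¹⟯, w = x + y * ι := by
    intro w hw
    have hww : φ (φ w) = w := by
      rw [hφ, hφ, ← pow_mul, ← pow_add, ← two_mul, ← hfr, pow_card_pow_finrank _ hw]
    -- These come from the parts of `w` on which `φ` acts as `1` and as `-1`; dividing the latter by
    -- `ι` makes it fixed.
    refine ⟨⟨(w + φ w) / 2, ?_⟩, ⟨(w - φ w) / (2 * ι), ?_⟩, ?_⟩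
    · rw [mem_iff_pow_card_pow_finrank, ← hd, ← hφ, map_div₀, map_add, hww, map_ofNat, add_comm]
    · rw [mem_iff_pow_card_pow_finrank, ← hd, ← hφ, map_div₀, map_sub, hww, map_mul, map_ofNat, hφι]
      field_simp
      ring
    · field_simp
      ring
  constructor
  · rintro ⟨w, hw, z, hz, rfl⟩
    obtain ⟨x₁, x₂, rfl⟩ := split w hw
    obtain ⟨x₃, x₄, rfl⟩ := split z hz
    refine ⟨x₁, x₂, x₃, x₄, ?_⟩
    rw [← hφ, ← hφ]
    simp [hE, hφι, quatMat, sub_eq_add_neg]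
  · rintro ⟨x₁, x₂, x₃, x₄, rfl⟩
    refine ⟨x₁ + x₂ * ι, add_mem (hle x₁.2) (mul_mem (hle x₂.2) hιβ),
      x₃ + x₄ * ι, add_mem (hle x₃.2) (mul_mem (hle x₄.2) hιβ), ?_⟩
    rw [← hφ, ← hφ]
    simp [hE, hφι, quatMat, sub_eq_add_neg]

lemma nonempty_theta {ι β : L} (hι : ι ^ 2 = -1) (h2 : (2 : L) ≠ 0)
    (hq : Fintype.card F % 4 = 3) (hβ : IsIntegral F β) (hβ0 : β ≠ 0)
    (hinv : aeval β⁻¹ (minpoly F β) = 0) (hne : β⁻¹ ≠ β)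
    {d : ℕ} (hd : Module.finrank F F⟮β + β⁻¹⟯ = d) (hodd : Odd d) {u v : F⟮β + β⁻¹⟯}
    (huv : u ^ 2 + v ^ 2 = -1) : Nonempty (Theta F ι β d u v) := by
  subst hd
  have huv' : (u : L) ^ 2 + (v : L) ^ 2 = -1 := by simpa using congrArg Subtype.val huv
  have h2' : (2 : F⟮β + β⁻¹⟯) ≠ 0 := fun h => h2 (congrArg Subtype.val h)
  -- `θ` is built backwards, as the inverse of an injective ring map defined on all of `Mat2 E`.
  -- That `S` is a ring then comes with its being a range.
  let Ψ : Mat2 F⟮β + β⁻¹⟯ →+* Mat2 L :=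
    (splitToQuatHom hι h2 huv').comp (toLHom F⟮β + β⁻¹⟯ : Mat2 F⟮β + β⁻¹⟯ →+* Mat2 L)
  have hΨ : Function.Injective Ψ :=
    (splitToQuatHom_injective hι h2 huv').comp (toL_injective F⟮β + β⁻¹⟯)
  have apply (x₁ x₂ x₃ x₄ : F⟮β + β⁻¹⟯) :
      Ψ (splitMat u v x₁ x₂ x₃ x₄) = quatMat ι (x₁ : L) x₂ x₃ x₄ := by
    change splitToQuat ι (u : L) v (toL (splitMat u v x₁ x₂ x₃ x₄)) = _
    rw [toL_splitMat, splitToQuat_splitMat h2 ι huv']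
  let e : Mat2 F⟮β + β⁻¹⟯ ≃+* Ψ.range := RingEquiv.ofBijective Ψ.rangeRestrict
    ⟨fun x y h => hΨ (congrArg (Subtype.val) h), Ψ.rangeRestrict_surjective⟩
  refine ⟨⟨Ψ.range, ?_, e.symm, fun x₁ x₂ x₃ x₄ => ⟨⟨_, apply x₁ x₂ x₃ x₄⟩, ?_⟩⟩⟩
  · ext M
    rw [range_quatMat hι h2 hq hβ hβ0 hinv hne hodd]
    constructor
    · rintro ⟨N, rfl⟩
      obtain ⟨x₁, x₂, x₃, x₄, rfl⟩ := splitMat_surjective h2' huv N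
      exact ⟨x₁, x₂, x₃, x₄, apply ..⟩
    · rintro ⟨x₁, x₂, x₃, x₄, rfl⟩
      exact ⟨_, apply ..⟩
  · rw [RingEquiv.symm_apply_eq]
    exact Subtype.ext (apply ..).symm

end Theta

/-! ### Factors of `X ^ n ∓ 1` and their roots. -/

namespace IsRecipFactorization

variable {F : Type*} [Field F] {L : Type*} [Field L] [Algebra F L] {P P₁ : F[X]} {r s : ℕ}
  {f : ℕ → F[X]}

lemma dvd (hf : IsRecipFactorization P P₁ r s f) {i : ℕ} (hi : i ∈ Finset.Icc 1 (r + s)) :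
    f i ∣ P := by
  rw [hf.prod_eq]
  rw [Finset.mem_Icc] at hi
  by_cases h : i ≤ r
  · exact (Finset.dvd_prod_of_mem f (Finset.mem_Icc.2 ⟨hi.1, h⟩)).mul_right _
  · exact ((dvd_mul_right (f i) (recip (f i))).trans (Finset.dvd_prod_of_mem
      (fun i => f i * recip (f i)) (Finset.mem_Icc.2 ⟨by omega, hi.2⟩))).mul_left _

lemma coeff_zero_ne_zero (hf : IsRecipFactorization P P₁ r s f) (h0 : P.coeff 0 ≠ 0) {i : ℕ}
    (hi : i ∈ Finset.Icc 1 (r + s)) : (f i).coeff 0 ≠ 0 := by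
  obtain ⟨q, hq⟩ := hf.dvd hi
  rw [hq, mul_coeff_zero] at h0
  exact left_ne_zero_of_mul h0

lemma aeval_eq_zero (hf : IsRecipFactorization P P₁ r s f) {i : ℕ}
    (hi : i ∈ Finset.Icc 1 (r + s)) {x : L} (hx : aeval x (f i) = 0) : aeval x P = 0 :=
  aeval_eq_zero_of_dvd_aeval_eq_zero (hf.dvd hi) hx

lemma minpoly_eq (hf : IsRecipFactorization P P₁ r s f) {i : ℕ}
    (hi : i ∈ Finset.Icc 1 (r + s)) {x : L} (hx : aeval x (f i) = 0) : minpoly F x = f i :=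
  (minpoly.eq_of_irreducible_of_monic (hf.irreducible i hi) hx (hf.monic i hi)).symm

lemma isIntegral (hf : IsRecipFactorization P P₁ r s f) {i : ℕ}
    (hi : i ∈ Finset.Icc 1 (r + s)) {x : L} (hx : aeval x (f i) = 0) : IsIntegral F x :=
  ⟨f i, hf.monic i hi, hx⟩

lemma aeval_inv_eq_zero (hf : IsRecipFactorization P P₁ r s f) (h0 : P.coeff 0 ≠ 0) {i : ℕ}
    (hi : i ∈ Finset.Icc 1 r) {x : L} (hx0 : x ≠ 0) (hx : aeval x (f i) = 0) :
    aeval x⁻¹ (f i) = 0 := by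
  have hi' : i ∈ Finset.Icc 1 (r + s) := Finset.Icc_subset_Icc_right (by omega) hi
  rw [← hf.selfRecip i hi, aeval_recip_inv_eq_zero_iff (hf.coeff_zero_ne_zero h0 hi') hx0, hx]

lemma natDegree_eq (hf : IsRecipFactorization P P₁ r s f) (h0 : P.coeff 0 ≠ 0) :
    P.natDegree = ∑ i ∈ Finset.Icc 1 r, (f i).natDegree +
      2 * ∑ i ∈ Finset.Icc (r + 1) (r + s), (f i).natDegree := by
  have hne : ∀ i ∈ Finset.Icc 1 (r + s), f i ≠ 0 := fun i hi => (hf.irreducible i hi).ne_zero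
  have hc : ∀ i ∈ Finset.Icc (r + 1) (r + s), (f i).coeff 0 ≠ 0 := fun i hi =>
    hf.coeff_zero_ne_zero h0 (Finset.Icc_subset_Icc_left (by omega) hi)
  have hne1 : ∀ i ∈ Finset.Icc 1 r, f i ≠ 0 := fun i hi =>
    hne i (Finset.Icc_subset_Icc_right (by omega) hi)
  have hne2 : ∀ i ∈ Finset.Icc (r + 1) (r + s), f i ≠ 0 := fun i hi =>
    hne i (Finset.Icc_subset_Icc_left (by omega) hi)
  have hne3 : ∀ i ∈ Finset.Icc (r + 1) (r + s), recip (f i) ≠ 0 := fun i hi =>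
    mul_ne_zero (C_ne_zero.2 (inv_ne_zero (hc i hi))) (by simpa using hne2 i hi)
  rw [hf.prod_eq, natDegree_mul (Finset.prod_ne_zero_iff.2 hne1) (Finset.prod_ne_zero_iff.2
    fun i hi => mul_ne_zero (hne2 i hi) (hne3 i hi)), natDegree_prod _ _ hne1,
    natDegree_prod _ _ fun i hi => mul_ne_zero (hne2 i hi) (hne3 i hi), Finset.mul_sum]
  congr 1
  refine Finset.sum_congr rfl fun i hi => ?_
  rw [natDegree_mul (hne2 i hi) (hne3 i hi), natDegree_recip (hc i hi), two_mul]

/-- A further self-reciprocal factor with root `c` would make `(X - c) ^ 2` divide `P`. -/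
lemma aeval_ne_zero_of_squarefree {c : F} (hf : IsRecipFactorization P (X - C c) r s f)
    (hP : Squarefree P) {i : ℕ} (hi : i ∈ Finset.Icc 2 r) : eval c (f i) ≠ 0 := by
  intro h
  rw [Finset.mem_Icc] at hi
  have h1 : X - C c ∣ f i := dvd_iff_isRoot.2 h
  have h2 : f 1 * f i ∣ P := by
    rw [hf.prod_eq]
    refine Dvd.dvd.mul_right ?_ _
    rw [← Finset.mul_prod_erase _ _ (Finset.mem_Icc.2 ⟨le_rfl, hf.one_le⟩)]
    exact mul_dvd_mul_left _ (Finset.dvd_prod_of_mem f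
      (Finset.mem_erase.2 ⟨by omega, Finset.mem_Icc.2 ⟨by omega, hi.2⟩⟩))
  rw [hf.first] at h2
  exact not_isUnit_X_sub_C c (hP _ ((mul_dvd_mul_left _ h1).trans h2))

lemma exists_root (hf : IsRecipFactorization P P₁ r s f) (h0 : P.coeff 0 ≠ 0) {z : L}
    (hz : aeval z P = 0) :
    ∃ i ∈ Finset.Icc 1 (r + s), aeval z (f i) = 0 ∨ aeval z⁻¹ (f i) = 0 := by
  have hz0 : z ≠ 0 := by
    rintro rfl
    rw [← coeff_zero_eq_aeval_zero'] at hz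
    exact h0 ((map_eq_zero _).1 hz)
  rw [hf.prod_eq, map_mul, mul_eq_zero, map_prod, map_prod, Finset.prod_eq_zero_iff,
    Finset.prod_eq_zero_iff] at hz
  rcases hz with ⟨i, hi, h⟩ | ⟨i, hi, h⟩
  · exact ⟨i, Finset.Icc_subset_Icc_right (by omega) hi, Or.inl h⟩
  · have hi' : i ∈ Finset.Icc 1 (r + s) := Finset.Icc_subset_Icc_left (by omega) hi
    refine ⟨i, hi', ?_⟩
    rw [map_mul, mul_eq_zero] at h
    refine h.imp id fun h => ?_
    rwa [← aeval_recip_inv_eq_zero_iff (hf.coeff_zero_ne_zero h0 hi') (inv_ne_zero hz0), inv_inv]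

/-- A polynomial that vanishes at one root of each factor and at its inverse vanishes at all
roots of the product. -/
lemma aeval_eq_zero_of_forall_root {Ω : Type*} [Field Ω] [Algebra F Ω]
    (hf : IsRecipFactorization P P₁ r s f) (h0 : P.coeff 0 ≠ 0) {α : ℕ → L}
    (hα : ∀ i ∈ Finset.Icc 1 (r + s), aeval (α i) (f i) = 0) {p : F[X]}
    (hp : ∀ i ∈ Finset.Icc 1 (r + s), aeval (α i) p = 0 ∧ aeval (α i)⁻¹ p = 0) {z : Ω}
    (hz : aeval z P = 0) : aeval z p = 0 := by
  obtain ⟨i, hi, h⟩ := hf.exists_root h0 hz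
  have hne : ∀ {M : Type _} [Field M] [Algebra F M] {y : M}, aeval y (f i) = 0 → y ≠ 0 := by
    rintro M _ _ _ hy rfl
    rw [← coeff_zero_eq_aeval_zero'] at hy
    exact hf.coeff_zero_ne_zero h0 hi ((map_eq_zero _).1 hy)
  -- Divisibility over `F` carries vanishing from the chosen root in `L` to roots in `Ω`; `L` need
  -- not contain all roots.
  have hdvd {q : F[X]} (hq : aeval (α i) q = 0) : f i ∣ q :=
    hf.minpoly_eq hi (hα i hi) ▸ minpoly.dvd F _ hq
  rcases h with h | h
  · exact aeval_eq_zero_of_dvd_aeval_eq_zero (hdvd (hp i hi).1) h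
  · have hα0 : α i ≠ 0 := by
      intro h0'
      have := hα i hi
      rw [h0', ← coeff_zero_eq_aeval_zero'] at this
      exact hf.coeff_zero_ne_zero h0 hi ((map_eq_zero _).1 this)
    -- When `z⁻¹` is the root of `f i`, the argument is applied to the reversed polynomial, which
    -- exchanges a root with its inverse.
    have hq : aeval (α i) p.reverse = 0 := by
      have := (aeval_reverse_inv_eq_zero_iff (inv_ne_zero hα0) p).2 (hp i hi).2
      rwa [inv_inv] at this
    have := aeval_eq_zero_of_dvd_aeval_eq_zero (hdvd hq) h
    rwa [aeval_reverse_inv_eq_zero_iff] at this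
    rintro rfl
    exact hne h inv_zero

end IsRecipFactorization

section RootsOfUnity

variable {F : Type*} [Field F]

lemma natCast_ne_zero_of_coprime_card [Fintype F] {m : ℕ}
    (h : Nat.Coprime (Fintype.card F) m) : (m : F) ≠ 0 := by
  intro h0
  have h1 : ringChar F ∣ m := (ringChar.spec F m).1 h0
  have h2 : ringChar F ∣ Fintype.card F := (ringChar.spec F _).1 (Nat.cast_card_eq_zero F)
  exact CharP.ringChar_ne_one (Nat.dvd_one.1 (h ▸ Nat.dvd_gcd h2 h1))

/-- The roots in question are those of the separable polynomial `X ^ (2n) - 1`: there are `2n` of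
them, too many for the degree of `p`. -/
lemma eq_zero_of_forall_aeval_eq_zero {n : ℕ} (h2n : ((2 * n : ℕ) : F) ≠ 0)
    {p : F[X]} (hdeg : p.degree < (2 * n : ℕ))
    (h₁ : ∀ z : AlgebraicClosure F, aeval z (X ^ n - 1 : F[X]) = 0 → aeval z p = 0)
    (h₂ : ∀ z : AlgebraicClosure F, aeval z (X ^ n + 1 : F[X]) = 0 → aeval z p = 0) : p = 0 := by
  have hsep : (X ^ (2 * n) - 1 : F[X]).Separable := X_pow_sub_one_separable_iff.2 h2n
  by_contra hp
  have hcard := card_rootSet_eq_natDegree (K := AlgebraicClosure F) hsep (IsAlgClosed.splits _)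
  rw [← Nat.card_eq_fintype_card, Nat.card_coe_set_eq, ← C_1, natDegree_X_pow_sub_C, C_1] at hcard
  have hsub : (X ^ (2 * n) - 1 : F[X]).rootSet (AlgebraicClosure F) ⊆
      p.rootSet (AlgebraicClosure F) := by
    intro z hz
    have hz := (mem_rootSet.1 hz).2
    rw [show (X ^ (2 * n) - 1 : F[X]) = (X ^ n - 1) * (X ^ n + 1) by ring, map_mul,
      mul_eq_zero] at hz
    exact mem_rootSet.2 ⟨hp, hz.elim (h₁ z) (h₂ z)⟩
  have hle := (Set.ncard_le_ncard hsub (rootSet_finite _ _)).trans (ncard_rootSet_le _ _)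
  rw [hcard] at hle
  exact absurd ((natDegree_lt_iff_degree_lt hp).2 hdeg) (not_lt.2 hle)

end RootsOfUnity

/-! ### The blocks: representation, hat map and kernel for each type. -/

section Blocks

open QuaternionGroup

variable {F : Type*} [Field F] {L : Type*} [Field L] [Algebra F L] {n : ℕ} [NeZero n]

/-- Both parts of `w` vanish at `x` and `x⁻¹`. -/
def PartsVanish (x : L) (w : MonoidAlgebra F (QuaternionGroup n)) : Prop :=
  (aeval x (aPart w) = 0 ∧ aeval x⁻¹ (aPart w) = 0) ∧
    (aeval x (xaPart w) = 0 ∧ aeval x⁻¹ (xaPart w) = 0)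

lemma exists_conj_block {E : IntermediateField F L} {Z : Mat2 L} (hZ : IsUnit Z.det)
    (ρ : MonoidAlgebra F (QuaternionGroup n) →ₐ[F] Mat2 L) (x y : Mat2 E)
    (hx : ρ (.of F _ (a 1)) * Z = Z * toL x) (hy : ρ (.of F _ (xa 0)) * Z = Z * toL y) :
    ∃ ρ' : MonoidAlgebra F (QuaternionGroup n) →ₐ[F] Mat2 E,
      ∀ w, toL (ρ' w) = conjBy Z (ρ w) := by
  let e := (conjByInvHom F Z hZ).comp (toLHom E)
  have he (X : Mat2 E) : e X = conjByInv Z (toL X) := rfl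
  obtain ⟨ρ', -, -, h⟩ := exists_algHom_factor ρ e (fun X Y hXY => toL_injective E (by
      rw [he, he] at hXY
      simpa only [conjBy_conjByInv hZ] using congrArg (conjBy Z) hXY)) x y
    (by rw [he, ← (conjBy_eq_iff hZ).2 hx, conjByInv_conjBy hZ])
    (by rw [he, ← (conjBy_eq_iff hZ).2 hy, conjByInv_conjBy hZ])
  exact ⟨ρ', fun w => by rw [← h w, he, conjBy_conjByInv hZ]⟩

lemma eq_zero_of_conjBy_eq_zero {Z X : Mat2 L} (hZ : IsUnit Z.det) (h : conjBy Z X = 0) :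
    X = 0 := by
  rw [← conjByInv_conjBy hZ X, h]
  simp [conjByInv]

lemma toL_zero {E : IntermediateField F L} : toL (0 : Mat2 E) = 0 := map_zero (toLHom E)

lemma isUnit_det_sigmaZ {x : L} (hne : x⁻¹ ≠ x) : IsUnit (sigmaZ x).det := by
  rw [isUnit_iff_ne_zero, sigmaZ, Matrix.det_fin_two_of]
  intro h
  exact hne (by linear_combination -h)

lemma isUnit_det_gammaZ {ι x : L} (hι : ι ^ 2 = -1) (hne : x⁻¹ ≠ x) :
    IsUnit (gammaZ ι x).det := by
  rw [isUnit_iff_ne_zero, gammaZ, Matrix.det_fin_two_of]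
  intro h
  exact hne (by linear_combination ι * h - (x - x⁻¹) * hι)

lemma exists_sigma_block {x : L} (hx : x ^ n = 1) (hne : x⁻¹ ≠ x) :
    ∃ ρ : MonoidAlgebra F (QuaternionGroup n) →ₐ[F] Mat2 F⟮x + x⁻¹⟯,
      toL (ρ (.of F _ (a 1))) = conjBy (sigmaZ x) (diagInv x) ∧
      toL (ρ (.of F _ (xa 0))) = conjBy (sigmaZ x) !![0, 1; 1, 0] ∧
      (∀ w, toL (ρ (hatMap w)) =
        conjBy (sigmaZ x) (mapK (conjByInv (sigmaZ x) (toL (ρ w))))) ∧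
      ∀ w, ρ w = 0 → PartsVanish x w := by
  have hx0 : x ≠ 0 := by rintro rfl; simp [NeZero.ne n] at hx
  have hZ := isUnit_det_sigmaZ hne
  obtain ⟨ρ, ha, hb⟩ := exists_quaternionRep (F := F) (x := x) (c := 1) (d := 1)
    (by rw [hx, one_mul]) (by rw [hx, one_pow])
  let y : F⟮x + x⁻¹⟯ := IntermediateField.AdjoinSimple.gen F (x + x⁻¹)
  have hy : (y : L) = x + x⁻¹ := rfl
  -- The columns of `Z` are `e = (1, 1)` and `-a e`. In this basis `a ^ 2 = y a - 1` and `b e = e`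
  -- leave only `y = x + x⁻¹` in the matrices of `a` and `b`.
  obtain ⟨ρ', h⟩ := exists_conj_block hZ ρ (E := F⟮x + x⁻¹⟯) !![0, 1; -1, y] !![1, -y; 0, -1]
    (by
      rw [ha]
      ext i j
      fin_cases i <;> fin_cases j <;>
        simp [sigmaZ, diagInv, toL, Matrix.mul_apply, Fin.sum_univ_two, hy]
      all_goals field_simp
      all_goals ring)
    (by
      rw [hb]
      ext i j
      fin_cases i <;> fin_cases j <;>
        simp [sigmaZ, toL, Matrix.mul_apply, Fin.sum_univ_two, hy])
  refine ⟨ρ', by rw [h, ha], by rw [h, hb], fun w => ?_, fun w hw => ?_⟩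
  · rw [h, h, conjByInv_conjBy hZ, quaternionRep_hatMap_mapK ha hb hx0]
  · refine aeval_parts_eq_zero_of_quaternionRep_eq_zero ha hb one_ne_zero one_ne_zero ?_
    exact eq_zero_of_conjBy_eq_zero hZ (by rw [← h, hw, toL_zero])

lemma exists_gamma_block {ι x : L} (hι : ι ^ 2 = -1) (hx : x ^ n = -1) (hne : x⁻¹ ≠ x)
    (hmem : ι ∈ F⟮x + x⁻¹⟯) :
    ∃ ρ : MonoidAlgebra F (QuaternionGroup n) →ₐ[F] Mat2 F⟮x + x⁻¹⟯,
      toL (ρ (.of F _ (a 1))) = conjBy (gammaZ ι x) (diagInv x) ∧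
      toL (ρ (.of F _ (xa 0))) = conjBy (gammaZ ι x) !![0, ι; ι, 0] ∧
      (∀ w, toL (ρ (hatMap w)) =
        conjBy (gammaZ ι x) (mapS (conjByInv (gammaZ ι x) (toL (ρ w))))) ∧
      ∀ w, ρ w = 0 → PartsVanish x w := by
  have hx0 : x ≠ 0 := by rintro rfl; simp [NeZero.ne n] at hx
  have hι0 : ι ≠ 0 := by rintro rfl; simp at hι
  have hZ := isUnit_det_gammaZ hι hne
  obtain ⟨ρ, ha, hb⟩ := exists_quaternionRep (F := F) (x := x) (c := ι) (d := ι)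
    (by rw [hx, ← sq, hι]) (by rw [hx]; ring)
  let y : F⟮x + x⁻¹⟯ := IntermediateField.AdjoinSimple.gen F (x + x⁻¹)
  have hy : (y : L) = x + x⁻¹ := rfl
  let j : F⟮x + x⁻¹⟯ := ⟨ι, hmem⟩
  have hj : (j : L) = ι := rfl
  obtain ⟨ρ', h⟩ := exists_conj_block hZ ρ (E := F⟮x + x⁻¹⟯) !![0, -j; -j, y] !![j, -y; 0, -j]
    (by
      rw [ha]
      ext i j
      fin_cases i <;> fin_cases j <;>
        simp [gammaZ, diagInv, toL, Matrix.mul_apply, Fin.sum_univ_two, hy, hj]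
      all_goals linear_combination hι + mul_inv_cancel₀ hx0)
    (by
      rw [hb]
      ext i j
      fin_cases i <;> fin_cases j <;>
        simp [gammaZ, toL, Matrix.mul_apply, Fin.sum_univ_two, hy, hj] <;> ring)
  refine ⟨ρ', by rw [h, ha], by rw [h, hb], fun w => ?_, fun w hw => ?_⟩
  · rw [h, h, conjByInv_conjBy hZ, quaternionRep_hatMap_mapS ha hb hx0 (by rw [← sq, hι])]
  · refine aeval_parts_eq_zero_of_quaternionRep_eq_zero ha hb hι0 hι0 ?_
    exact eq_zero_of_conjBy_eq_zero hZ (by rw [← h, hw, toL_zero])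

lemma exists_rest_block {x : L} (c d : F) (hcd : algebraMap F L (c * d) = x ^ n)
    (hx : (x ^ n) ^ 2 = 1) :
    ∃ (ρ : MonoidAlgebra F (QuaternionGroup n) →ₐ[F] Mat2 F⟮x⟯)
      (ρ' : MonoidAlgebra F (QuaternionGroup n) →ₐ[F] Mat2 L), (∀ w, toL (ρ w) = ρ' w) ∧
      ρ' (.of F _ (a 1)) = diagInv x ∧
      ρ' (.of F _ (xa 0)) = !![0, algebraMap F L c; algebraMap F L d, 0] ∧
      ∀ w, ρ w = 0 → PartsVanish x w := by
  obtain ⟨ρ', ha, hb⟩ := exists_quaternionRep (F := F) (x := x) (c := algebraMap F L c)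
    (d := algebraMap F L d) (by rw [← hcd, map_mul]) hx
  have hcd0 : algebraMap F L c * algebraMap F L d ≠ 0 := by
    rw [← map_mul, hcd]
    rintro h
    simp [h] at hx
  obtain ⟨ρ, -, -, h⟩ := exists_algHom_factor ρ' (toLHom F⟮x⟯) (toL_injective _)
    (diagInv (IntermediateField.AdjoinSimple.gen F x))
    !![0, algebraMap F F⟮x⟯ c; algebraMap F F⟮x⟯ d, 0]
    (by
      rw [ha, toLHom_apply]
      ext i j
      fin_cases i <;> fin_cases j <;> simp [diagInv, toL])
    (by
      rw [hb, toLHom_apply]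
      ext i j
      fin_cases i <;> fin_cases j <;> simp [toL])
  refine ⟨ρ, ρ', h, ha, hb, fun w hw => ?_⟩
  refine aeval_parts_eq_zero_of_quaternionRep_eq_zero ha hb (left_ne_zero_of_mul hcd0)
    (right_ne_zero_of_mul hcd0) ?_
  rw [← h, hw, map_zero]

lemma exists_rest_block_mapK {x : L} (hx : x ^ n = 1) :
    ∃ ρ : MonoidAlgebra F (QuaternionGroup n) →ₐ[F] Mat2 F⟮x⟯,
      toL (ρ (.of F _ (a 1))) = diagInv x ∧ toL (ρ (.of F _ (xa 0))) = !![0, 1; 1, 0] ∧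
      (∀ w, ρ (hatMap w) = mapK (ρ w)) ∧ ∀ w, ρ w = 0 → PartsVanish x w := by
  have hx0 : x ≠ 0 := by rintro rfl; simp [NeZero.ne n] at hx
  obtain ⟨ρ, ρ', h, ha, hb, hv⟩ := exists_rest_block (F := F) (x := x) 1 1
    (by rw [hx, one_mul, map_one]) (by rw [hx, one_pow])
  rw [map_one] at hb
  refine ⟨ρ, by rw [h, ha], by rw [h, hb], fun w => toL_injective _ ?_, hv⟩
  rw [toL_mapK, h, h, quaternionRep_hatMap_mapK ha hb hx0]

lemma exists_rest_block_mapS {x : L} (hx : x ^ n = -1) :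
    ∃ ρ : MonoidAlgebra F (QuaternionGroup n) →ₐ[F] Mat2 F⟮x⟯,
      toL (ρ (.of F _ (a 1))) = diagInv x ∧ toL (ρ (.of F _ (xa 0))) = !![0, -1; 1, 0] ∧
      (∀ w, ρ (hatMap w) = mapS (ρ w)) ∧ ∀ w, ρ w = 0 → PartsVanish x w := by
  have hx0 : x ≠ 0 := by rintro rfl; simp [NeZero.ne n] at hx
  obtain ⟨ρ, ρ', h, ha, hb, hv⟩ := exists_rest_block (F := F) (x := x) (-1) 1
    (by rw [hx, mul_one, map_neg, map_one]) (by rw [hx]; ring)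
  rw [map_neg, map_one] at hb
  refine ⟨ρ, by rw [h, ha], by rw [h, hb], fun w => toL_injective _ ?_, hv⟩
  rw [toL_mapS, h, h, quaternionRep_hatMap_mapS ha hb hx0 (by ring)]

/-- `Theta` provides only a ring isomorphism; its linearity over `F` follows from the formula at `x₂
= x₃ = x₄ = 0`. -/
lemma Theta.commutes [Fintype F] {ι β : L} {d : ℕ} {u v : F⟮β + β⁻¹⟯} (T : Theta F ι β d u v)
    (c : F) : (T.iso.symm (algebraMap F _ c) : Mat2 L) = algebraMap F _ c := by
  obtain ⟨h, h'⟩ := T.iso_apply (algebraMap F _ c) 0 0 0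
  have : T.iso ⟨_, h⟩ = algebraMap F (Mat2 F⟮β + β⁻¹⟯) c := by
    rw [h']
    ext i j
    fin_cases i <;> fin_cases j <;> simp [Matrix.algebraMap_matrix_apply]
  rw [← this, RingEquiv.symm_apply_apply]
  ext i j
  fin_cases i <;> fin_cases j <;> simp [Matrix.algebraMap_matrix_apply]

/-- The inverse of `θ` as an algebra homomorphism. -/
def Theta.symmHom [Fintype F] {ι β : L} {d : ℕ} {u v : F⟮β + β⁻¹⟯} (T : Theta F ι β d u v) :
    Mat2 F⟮β + β⁻¹⟯ →ₐ[F] Mat2 L :=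
  { T.S.subtype.comp (T.iso.symm : Mat2 F⟮β + β⁻¹⟯ →+* T.S) with commutes' := T.commutes }

lemma exists_theta_block [Fintype F] {ι x : L} (hι : ι ^ 2 = -1) (hx : x ^ n = -1)
    {d : ℕ} (hιx : ι ∈ F⟮x⟯) (hιd : ι ^ Fintype.card F ^ d = -ι)
    (hxd : x ^ Fintype.card F ^ d = x⁻¹) {u v : F⟮x + x⁻¹⟯} (T : Theta F ι x d u v) :
    ∃ ρ : MonoidAlgebra F (QuaternionGroup n) →ₐ[F] Mat2 F⟮x + x⁻¹⟯,
      (∃ h : diagInv x ∈ T.S, ρ (.of F _ (a 1)) = T.iso ⟨_, h⟩) ∧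
      (∃ h : !![0, ι; ι, 0] ∈ T.S, ρ (.of F _ (xa 0)) = T.iso ⟨_, h⟩) ∧
      (∀ w, ∃ h : mapS (T.iso.symm (ρ w) : Mat2 L) ∈ T.S, ρ (hatMap w) = T.iso ⟨_, h⟩) ∧
      ∀ w, ρ w = 0 → PartsVanish x w := by
  have hx0 : x ≠ 0 := by rintro rfl; simp [NeZero.ne n] at hx
  have hι0 : ι ≠ 0 := by rintro rfl; simp at hι
  have hq0 : Fintype.card F ^ d ≠ 0 := pow_ne_zero _ Fintype.card_ne_zero
  have memS {M : Mat2 L} : M ∈ T.S ↔ M ∈ quatSet F x d := by rw [← T.coe_S]; rfl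
  have hD : diagInv x ∈ T.S := memS.2 ⟨x, IntermediateField.mem_adjoin_simple_self F x, 0,
    zero_mem _, by simp [diagInv, hxd, zero_pow hq0]⟩
  have hB : !![0, ι; ι, 0] ∈ T.S := memS.2 ⟨0, zero_mem _, ι, hιx, by
    simp [hιd, zero_pow hq0]⟩
  obtain ⟨ρ', ha, hb⟩ := exists_quaternionRep (F := F) (x := x) (c := ι) (d := ι)
    (by rw [hx, ← sq, hι]) (by rw [hx]; ring)
  have he (X) : T.symmHom X = (T.iso.symm X : Mat2 L) := rfl
  obtain ⟨ρ, hρa, hρb, h⟩ := exists_algHom_factor ρ' T.symmHom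
    (Subtype.val_injective.comp T.iso.symm.injective) (T.iso ⟨_, hD⟩) (T.iso ⟨_, hB⟩)
    (by rw [he, RingEquiv.symm_apply_apply, ha]) (by rw [he, RingEquiv.symm_apply_apply, hb])
  refine ⟨ρ, ⟨hD, hρa⟩, ⟨hB, hρb⟩, fun w => ?_, fun w hw => ?_⟩
  -- This also shows that `mapS` stays inside `S` here.
  · have key : mapS (T.iso.symm (ρ w) : Mat2 L) = (T.iso.symm (ρ (hatMap w)) : Mat2 L) := by
      rw [← he, ← he, h, h, quaternionRep_hatMap_mapS ha hb hx0 (by rw [← sq, hι])]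
    refine ⟨key ▸ (T.iso.symm (ρ (hatMap w))).2, ?_⟩
    rw [← RingEquiv.symm_apply_eq]
    exact Subtype.ext key.symm
  · refine aeval_parts_eq_zero_of_quaternionRep_eq_zero ha hb hι0 hι0 ?_
    rw [← h, hw, map_zero]

lemma exists_prod_block (h2 : (2 : F) ≠ 0) :
    ∃ ρ : MonoidAlgebra F (QuaternionGroup n) →ₐ[F] F × F,
      ρ (.of F _ (a 1)) = (1, 1) ∧ ρ (.of F _ (xa 0)) = (1, -1) ∧
      (∀ w, ρ (hatMap w) = ρ w) ∧
      ∀ w, ρ w = 0 → eval 1 (aPart w) = 0 ∧ eval 1 (xaPart w) = 0 := by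
  obtain ⟨ρ, ha, hb⟩ : ∃ ρ : MonoidAlgebra F (QuaternionGroup n) →ₐ[F] F × F,
      ρ (.of F _ (a 1)) = (1, 1) ∧ ρ (.of F _ (xa 0)) = (1, -1) :=
    ⟨quaternionAlgebraLift (F := F) (1, 1) (1, -1) (by simp) (by simp) (by simp),
      quaternionAlgebraLift_a .., quaternionAlgebraLift_xa ..⟩
  refine ⟨ρ, ha, hb, fun w => ?_, fun w hw => ?_⟩
  · exact algHom_hatMap ρ LinearMap.id rfl (fun X Y => mul_comm _ _) (by rw [ha]; simp)
      (by rw [hb]; simp) w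
  · have e : (aeval ((1, 1) : F × F) : F[X] →ₐ[F] F × F) = (aeval (1 : F)).prod (aeval (1 : F)) := by
      ext <;> simp
    rw [algHom_apply_eq, ha, hb, e] at hw
    have h1 : eval 1 (aPart w) + eval 1 (xaPart w) = 0 := by simpa using congrArg Prod.fst hw
    have h3 : eval 1 (aPart w) - eval 1 (xaPart w) = 0 := by
      simpa [sub_eq_add_neg] using congrArg Prod.snd hw
    constructor <;> refine (mul_eq_zero_iff_left h2).1 ?_
    · linear_combination h1 + h3
    · linear_combination h1 - h3

lemma exists_iota_block [Fintype F] {ι : L} (hι : ι ^ 2 = -1) (h2 : (2 : L) ≠ 0)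
    (hq : Fintype.card F % 4 = 3) (hn : Odd n) :
    ∃ ρ : MonoidAlgebra F (QuaternionGroup n) →ₐ[F] F⟮ι⟯,
      (ρ (.of F _ (a 1)) : L) = -1 ∧ (ρ (.of F _ (xa 0)) : L) = ι ∧
      (∀ w, ρ (hatMap w) = ρ w ^ Fintype.card F) ∧
      ∀ w, ρ w = 0 → eval (-1) (aPart w) = 0 ∧ eval (-1) (xaPart w) = 0 := by
  let j : F⟮ι⟯ := IntermediateField.AdjoinSimple.gen F ι
  have hj : j ^ 2 = -1 := Subtype.ext hι
  have hι0 : ι ≠ 0 := by rintro rfl; simp at hι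
  have hιq : ι ^ Fintype.card F = -ι := by simpa using iota_pow_card_pow hι hq 1
  have hjq : j ^ Fintype.card F = -j := Subtype.ext hιq
  have hodd : Odd (Fintype.card F) := Nat.odd_iff.2 (by omega)
  obtain ⟨ρ, ha, hb⟩ : ∃ ρ : MonoidAlgebra F (QuaternionGroup n) →ₐ[F] F⟮ι⟯,
      ρ (.of F _ (a 1)) = -1 ∧ ρ (.of F _ (xa 0)) = j :=
    ⟨quaternionAlgebraLift (-1) j (by rw [pow_mul]; simp) (by rw [← sq, hj, hn.neg_one_pow])
      (by ring), quaternionAlgebraLift_a .., quaternionAlgebraLift_xa ..⟩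
  refine ⟨ρ, by rw [ha]; rfl, by rw [hb]; rfl, fun w => ?_, fun w hw => ?_⟩
  · refine algHom_hatMap ρ (FiniteField.frobeniusAlgHom F F⟮ι⟯).toLinearMap
      (map_one (FiniteField.frobeniusAlgHom F F⟮ι⟯))
      (fun X Y => (map_mul (FiniteField.frobeniusAlgHom F F⟮ι⟯) X Y).trans (mul_comm _ _)) ?_ ?_ w
    · change ρ _ ^ _ * ρ _ = 1
      rw [ha, hodd.neg_one_pow]
      ring
    · change ρ _ ^ _ * ρ _ = 1
      rw [hb, hjq]
      linear_combination -hj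
  · have e (p : F[X]) : aeval (-1 : F⟮ι⟯) p = algebraMap F F⟮ι⟯ (eval (-1) p) := by
      rw [← aeval_algebraMap_apply_eq_algebraMap_eval, map_neg, map_one]
    rw [algHom_apply_eq, ha, hb, e, e] at hw
    have hL : algebraMap F L (eval (-1) (aPart w)) +
        ι * algebraMap F L (eval (-1) (xaPart w)) = 0 := congrArg Subtype.val hw
    -- Frobenius fixes the two values, which lie in `F`, and negates `ι`; adding and dividing by `2`
    -- separates them.
    have hL' := congrArg (FiniteField.frobeniusAlgHom F L) hL
    rw [map_add, map_mul, map_zero, AlgHom.commutes, AlgHom.commutes,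
      FiniteField.frobeniusAlgHom_apply, hιq] at hL'
    have h1 : algebraMap F L (eval (-1) (aPart w)) = 0 :=
      (mul_eq_zero_iff_left h2).1 (by linear_combination hL + hL')
    rw [h1, zero_add, mul_eq_zero, or_iff_right hι0] at hL
    exact ⟨(map_eq_zero _).1 h1, (map_eq_zero _).1 hL⟩

end Blocks

/-! ### Dimension count. -/

lemma finrank_adjoin_iota_le {F : Type*} [Field F] {L : Type*} [Field L] [Algebra F L] {ι : L}
    (hι : ι ^ 2 = -1) : FiniteDimensional F F⟮ι⟯ ∧ Module.finrank F F⟮ι⟯ ≤ 2 := by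
  have hdeg : (X ^ 2 + 1 : F[X]).natDegree = 2 := natDegree_X_pow_add_C (r := (1 : F))
  have hmonic : (X ^ 2 + 1 : F[X]).Monic := monic_X_pow_add_C (1 : F) two_ne_zero
  have h0 : aeval ι (X ^ 2 + 1 : F[X]) = 0 := by simp [hι]
  have hint : IsIntegral F ι := ⟨_, hmonic, h0⟩
  refine ⟨IntermediateField.adjoin.finiteDimensional hint, ?_⟩
  rw [IntermediateField.adjoin.finrank hint, ← hdeg]
  exact natDegree_le_of_dvd (minpoly.dvd F ι h0) hmonic.ne_zero

/-- The dimension of a sum of matrix blocks indexed by the factors of `P`. -/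
lemma IsRecipFactorization.finrank_blocks {F : Type*} [Field F] {P : F[X]} {c : F} {r s : ℕ}
    {f : ℕ → F[X]} (hf : IsRecipFactorization P (X - C c) r s f) (h0 : P.coeff 0 ≠ 0)
    (V : Type*) [AddCommGroup V] [Module F V] [FiniteDimensional F V]
    (hV : Module.finrank F V ≤ 2)
    (E : Set.Icc 2 r → Type*) [∀ i, AddCommGroup (E i)] [∀ i, Module F (E i)]
    [∀ i, FiniteDimensional F (E i)]
    (hE : ∀ i : Set.Icc 2 r, (f i).natDegree = 2 * Module.finrank F (E i))
    (G : Set.Icc (r + 1) (r + s) → Type*) [∀ i, AddCommGroup (G i)] [∀ i, Module F (G i)]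
    [∀ i, FiniteDimensional F (G i)]
    (hG : ∀ i : Set.Icc (r + 1) (r + s), (f i).natDegree = Module.finrank F (G i)) :
    FiniteDimensional F (V × (∀ i, Mat2 (E i)) × (∀ i, Mat2 (G i))) ∧
      Module.finrank F (V × (∀ i, Mat2 (E i)) × (∀ i, Mat2 (G i))) ≤ 2 * P.natDegree := by
  refine ⟨inferInstance, ?_⟩
  have h1 : ∑ i : Set.Icc 2 r, (f i).natDegree = ∑ i ∈ Finset.Icc 2 r, (f i).natDegree := by
    rw [Finset.sum_set_coe (Set.Icc 2 r) (f := fun i => (f i).natDegree), Set.toFinset_Icc]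
  have h2 : ∑ i : Set.Icc (r + 1) (r + s), (f i).natDegree =
      ∑ i ∈ Finset.Icc (r + 1) (r + s), (f i).natDegree := by
    rw [Finset.sum_set_coe (Set.Icc (r + 1) (r + s)) (f := fun i => (f i).natDegree),
      Set.toFinset_Icc]
  have h3 : ∑ i ∈ Finset.Icc 1 r, (f i).natDegree =
      1 + ∑ i ∈ Finset.Icc 2 r, (f i).natDegree := by
    rw [← Finset.sum_Ioc_add_eq_sum_Icc hf.one_le, add_comm, hf.first, natDegree_X_sub_C]
    rfl
  -- A matrix block has four times the dimension of its entries: `2 deg f` for self-reciprocal `f`,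
  -- and `4 deg f = 2 deg (f f*)` for a pair. The first block has at most `2 = 2 deg (X - c)`.
  rw [hf.natDegree_eq h0, h3, ← h1, ← h2, Module.finrank_prod, Module.finrank_prod,
    Module.finrank_pi_fintype, Module.finrank_pi_fintype]
  simp only [Module.finrank_matrix, Fintype.card_fin, hE, hG, ← Finset.mul_sum]
  omega

namespace IsRecipFactorization

variable {F : Type*} [Field F] {L : Type*} [Field L] [Algebra F L] {P P₁ : F[X]} {r s : ℕ}
  {f : ℕ → F[X]}

lemma ne_of_mem_Icc_two {c : F} (hf : IsRecipFactorization P (X - C c) r s f)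
    (hP : Squarefree P) {i : ℕ} (hi : i ∈ Set.Icc 2 r) {x : L} (hx : aeval x (f i) = 0) :
    x ≠ algebraMap F L c := by
  rintro rfl
  rw [aeval_algebraMap_apply, map_eq_zero, coe_aeval_eq_eval] at hx
  exact hf.aeval_ne_zero_of_squarefree hP (by simpa using hi) hx

end IsRecipFactorization

lemma bijective_of_injective_of_finrank_le {F : Type*} [Field F] {n : ℕ} [NeZero n]
    {A B : Type*} [Ring A] [Algebra F A] [Ring B] [Algebra F B]
    (φ : MonoidAlgebra F (QuaternionGroup n) →ₐ[F] A × B) (hφ : Function.Injective φ)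
    (_ : FiniteDimensional F A) (_ : FiniteDimensional F B) (hA : Module.finrank F A ≤ 2 * n)
    (hB : Module.finrank F B ≤ 2 * n) : Function.Bijective φ := by
  have e : MonoidAlgebra F (QuaternionGroup n) ≃ₗ[F] QuaternionGroup n →₀ F :=
    MonoidAlgebra.coeffLinearEquiv F
  have : FiniteDimensional F (MonoidAlgebra F (QuaternionGroup n)) := Module.Finite.equiv e.symm
  have h1 : Module.finrank F (MonoidAlgebra F (QuaternionGroup n)) = 4 * n := by
    rw [e.finrank_eq, Module.finrank_finsupp_self, QuaternionGroup.card]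
  have h2 : Module.finrank F (A × B) ≤ 4 * n := by rw [Module.finrank_prod]; omega
  have h3 := LinearMap.finrank_le_finrank_of_injective (f := φ.toLinearMap) hφ
  exact ⟨hφ, (LinearMap.injective_iff_surjective_of_finrank_eq_finrank (f := φ.toLinearMap)
    (by omega)).1 hφ⟩

end

/-! ### Assembly of the blocks. -/

theorem theorem4p6
    {F : Type*} [Field F] [Fintype F] {L : Type*} [Field L] [Algebra F L]
    (n : ℕ) (hn : Odd n)
    (hcop : Nat.Coprime (Fintype.card F) (4 * n)) (hq : Fintype.card F % 4 = 3)
    (r s t k : ℕ) (f g : ℕ → F[X])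
    (hf : IsRecipFactorization (X ^ n - 1) (X - 1) r s f)
    (hg : IsRecipFactorization (X ^ n + 1) (X + 1) t k g)
    (α β : ℕ → L)
    (hα : ∀ i ∈ Finset.Icc 1 (r + s), aeval (α i) (f i) = 0)
    (hβ : ∀ j ∈ Finset.Icc 1 (t + k), aeval (β j) (g j) = 0)
    (ι : L) (hι : ι ^ 2 = -1)
    (u v : ∀ j, F⟮β j + (β j)⁻¹⟯)
    (huv : ∀ j ∈ Set.Icc 2 t, ¬ 4 ∣ (g j).natDegree → u j ^ 2 + v j ^ 2 = -1) :
    ∃ θ : ∀ j ∈ Set.Icc 2 t, ¬ 4 ∣ (g j).natDegree →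
        Theta F ι (β j) ((g j).natDegree / 2) (u j) (v j),
      ∃ ψ : MonoidAlgebra F (QuaternionGroup n) ≃ₐ[F]
          BlocksA F α r s × BlocksB F ι β t k,
        IsPsi θ ψ ∧
        ∃ ν : BlocksA F α r s × BlocksB F ι β t k → BlocksA F α r s × BlocksB F ι β t k,
          (∀ x, IsVarphi x.1 (ν x).1 ∧ IsPhi θ x.2 (ν x).2) ∧
          ∀ w : MonoidAlgebra F (QuaternionGroup n), ψ (hatMap w) = ν (ψ w) := by
  have hn0 : n ≠ 0 := by rintro rfl; simp at hn
  have : NeZero n := ⟨hn0⟩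
  -- arithmetic in `F` and `L`
  have h4n : ((4 * n : ℕ) : F) ≠ 0 := natCast_ne_zero_of_coprime_card hcop
  have h2F : (2 : F) ≠ 0 := fun h => h4n (by push_cast; linear_combination 2 * (n : F) * h)
  have h2L : (2 : L) ≠ 0 := by
    rw [← map_ofNat (algebraMap F L) 2]; exact (_root_.map_ne_zero _).2 h2F
  have h2n : ((2 * n : ℕ) : F) ≠ 0 := fun h => h4n (by
    push_cast at h ⊢; linear_combination 2 * h)
  have hsep : (X ^ (2 * n) - 1 : F[X]).Separable := X_pow_sub_one_separable_iff.2 h2n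
  have hfac : (X ^ (2 * n) - 1 : F[X]) = (X ^ n - 1) * (X ^ n + 1) := by ring
  have hsqf : Squarefree (X ^ n - 1 : F[X]) :=
    (hsep.of_dvd (hfac ▸ dvd_mul_right _ _)).squarefree
  have hsqg : Squarefree (X ^ n + 1 : F[X]) :=
    (hsep.of_dvd (hfac ▸ dvd_mul_left _ _)).squarefree
  have h0f : (X ^ n - 1 : F[X]).coeff 0 ≠ 0 := by simp [coeff_X_pow, hn0.symm]
  have h0g : (X ^ n + 1 : F[X]).coeff 0 ≠ 0 := by simp [coeff_X_pow, hn0.symm]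
  have hf' : IsRecipFactorization (X ^ n - 1) (X - C 1) r s f := by rwa [C_1]
  have hg' : IsRecipFactorization (X ^ n + 1) (X - C (-1)) t k g := by
    rwa [C_neg, C_1, sub_neg_eq_add]
  -- the roots
  have hαn (i) (hi : i ∈ Finset.Icc 1 (r + s)) : α i ^ n = 1 := by
    have := hf.aeval_eq_zero hi (hα i hi)
    rwa [map_sub, map_pow, aeval_X, map_one, sub_eq_zero] at this
  have hβn (j) (hj : j ∈ Finset.Icc 1 (t + k)) : β j ^ n = -1 := by
    have := hg.aeval_eq_zero hj (hβ j hj)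
    rwa [map_add, map_pow, aeval_X, map_one, add_eq_zero_iff_eq_neg] at this
  have hα0 (i) (hi : i ∈ Finset.Icc 1 (r + s)) : α i ≠ 0 := fun h => by
    have := hαn i hi
    simp [h, hn0] at this
  have hβ0 (j) (hj : j ∈ Finset.Icc 1 (t + k)) : β j ≠ 0 := fun h => by
    have := hβn j hj
    simp [h, hn0] at this
  have mid {m l : ℕ} {i : ℕ} (hi : i ∈ Set.Icc 2 m) : i ∈ Finset.Icc 1 (m + l) := by
    rw [Set.mem_Icc] at hi; rw [Finset.mem_Icc]; omega
  have mid' {m : ℕ} {i : ℕ} (hi : i ∈ Set.Icc 2 m) : i ∈ Finset.Icc 1 m := by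
    rw [Set.mem_Icc] at hi; rw [Finset.mem_Icc]; omega
  have last {m l : ℕ} {i : ℕ} (hi : i ∈ Set.Icc (m + 1) (m + l)) :
      i ∈ Finset.Icc 1 (m + l) := by
    rw [Set.mem_Icc] at hi; rw [Finset.mem_Icc]; omega
  have inv_ne {x : L} (hx0 : x ≠ 0) (h1 : x ≠ 1) (h2 : x ≠ -1) : x⁻¹ ≠ x := fun h => by
    have := mul_inv_cancel₀ hx0
    rw [h, mul_self_eq_one_iff] at this
    exact this.elim h1 h2
  have one_ne : (1 : L) ≠ -1 := fun h => h2L (by linear_combination h)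
  -- Only `±1` are self-inverse: `1` is already the root of `f 1`, and `-1` is not an `n`-th root of
  -- unity for odd `n`. The roles are exchanged for `β`.
  have hαne (i) (hi : i ∈ Set.Icc 2 r) : (α i)⁻¹ ≠ α i := by
    refine inv_ne (hα0 i (mid hi)) ?_ fun h => ?_
    · simpa using hf'.ne_of_mem_Icc_two hsqf hi (hα i (mid hi))
    · have := hαn i (mid hi)
      rw [h, hn.neg_one_pow] at this
      exact one_ne this.symm
  have hβne (j) (hj : j ∈ Set.Icc 2 t) : (β j)⁻¹ ≠ β j := by
    refine inv_ne (hβ0 j (mid hj)) (fun h => ?_) ?_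
    · have := hβn j (mid hj)
      rw [h, one_pow] at this
      exact one_ne this
    · simpa using hg'.ne_of_mem_Icc_two hsqg hj (hβ j (mid hj))
  have hαint (i) (hi : i ∈ Finset.Icc 1 (r + s)) : IsIntegral F (α i) :=
    hf.isIntegral hi (hα i hi)
  have hβint (j) (hj : j ∈ Finset.Icc 1 (t + k)) : IsIntegral F (β j) :=
    hg.isIntegral hj (hβ j hj)
  have hαinv (i) (hi : i ∈ Set.Icc 2 r) : aeval (α i)⁻¹ (minpoly F (α i)) = 0 := by
    rw [hf.minpoly_eq (mid hi) (hα i (mid hi))]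
    exact hf.aeval_inv_eq_zero h0f (mid' hi) (hα0 i (mid hi)) (hα i (mid hi))
  have hβinv (j) (hj : j ∈ Set.Icc 2 t) : aeval (β j)⁻¹ (minpoly F (β j)) = 0 := by
    rw [hg.minpoly_eq (mid hj) (hβ j (mid hj))]
    exact hg.aeval_inv_eq_zero h0g (mid' hj) (hβ0 j (mid hj)) (hβ j (mid hj))
  have hαdeg (i) (hi : i ∈ Finset.Icc 1 (r + s)) :
      (f i).natDegree = Module.finrank F F⟮α i⟯ := by
    rw [IntermediateField.adjoin.finrank (hαint i hi), hf.minpoly_eq hi (hα i hi)]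
  have hβdeg (j) (hj : j ∈ Finset.Icc 1 (t + k)) :
      (g j).natDegree = Module.finrank F F⟮β j⟯ := by
    rw [IntermediateField.adjoin.finrank (hβint j hj), hg.minpoly_eq hj (hβ j hj)]
  have hαdeg2 (i) (hi : i ∈ Set.Icc 2 r) :
      (f i).natDegree = 2 * Module.finrank F F⟮α i + (α i)⁻¹⟯ := by
    rw [hαdeg i (mid hi), finrank_adjoin_eq_two_mul (hαint i (mid hi)) (hαinv i hi) (hαne i hi)
      (hα0 i (mid hi))]
  have hβdeg2 (j) (hj : j ∈ Set.Icc 2 t) :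
      (g j).natDegree = 2 * Module.finrank F F⟮β j + (β j)⁻¹⟯ := by
    rw [hβdeg j (mid hj), finrank_adjoin_eq_two_mul (hβint j (mid hj)) (hβinv j hj) (hβne j hj)
      (hβ0 j (mid hj))]
  have hhalf (j) (hj : j ∈ Set.Icc 2 t) :
      Module.finrank F F⟮β j + (β j)⁻¹⟯ = (g j).natDegree / 2 := by
    have := hβdeg2 j hj; omega
  have hodd (j) (hj : j ∈ Set.Icc 2 t) (h4 : ¬ 4 ∣ (g j).natDegree) :
      Odd ((g j).natDegree / 2) := by
    have := hβdeg2 j hj; rw [Nat.odd_iff]; omega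
  have hfinαmid (i : Set.Icc 2 r) : FiniteDimensional F F⟮α i + (α i)⁻¹⟯ :=
    finiteDimensional_adjoin_add_inv (hαint i (mid i.2))
  have hfinβmid (j : Set.Icc 2 t) : FiniteDimensional F F⟮β j + (β j)⁻¹⟯ :=
    finiteDimensional_adjoin_add_inv (hβint j (mid j.2))
  have hfinα (i : Set.Icc (r + 1) (r + s)) : FiniteDimensional F F⟮α i⟯ :=
    IntermediateField.adjoin.finiteDimensional (hαint i (last i.2))
  have hfinβ (j : Set.Icc (t + 1) (t + k)) : FiniteDimensional F F⟮β j⟯ :=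
    IntermediateField.adjoin.finiteDimensional (hβint j (last j.2))
  obtain ⟨hfinι, hιdeg⟩ := finrank_adjoin_iota_le (F := F) hι
  -- the isomorphisms `θ`
  have hθ (j) (hj : j ∈ Set.Icc 2 t) (h4 : ¬ 4 ∣ (g j).natDegree) :
      Nonempty (Theta F ι (β j) ((g j).natDegree / 2) (u j) (v j)) :=
    nonempty_theta hι h2L hq (hβint j (mid hj)) (hβ0 j (mid hj)) (hβinv j hj) (hβne j hj)
      (hhalf j hj) (hodd j hj h4) (huv j hj h4)
  let θ : ∀ j ∈ Set.Icc 2 t, ¬ 4 ∣ (g j).natDegree →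
      Theta F ι (β j) ((g j).natDegree / 2) (u j) (v j) := fun j hj h4 => (hθ j hj h4).some
  refine ⟨θ, ?_⟩
  -- Only the defining properties of `θ` matter from here on.
  generalize θ = θ
  -- the blocks
  obtain ⟨ρA₁, hA₁a, hA₁b, hA₁hat, hA₁v⟩ := exists_prod_block (F := F) (n := n) h2F
  choose ρA hAa hAb hAhat hAv using fun i : Set.Icc 2 r =>
    exists_sigma_block (F := F) (hαn i (mid i.2)) (hαne i i.2)
  choose ρA' hA'a hA'b hA'hat hA'v using fun i : Set.Icc (r + 1) (r + s) =>
    exists_rest_block_mapK (F := F) (hαn i (last i.2))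
  obtain ⟨ρB₁, hB₁a, hB₁b, hB₁hat, hB₁v⟩ := exists_iota_block (F := F) hι h2L hq hn
  -- Both cases share the target `Mat2 E`, so one conditional statement yields a single family of
  -- representations.
  have hB (j : Set.Icc 2 t) : ∃ ρ : MonoidAlgebra F (QuaternionGroup n) →ₐ[F]
        Mat2 F⟮β j + (β j)⁻¹⟯,
      (4 ∣ (g j).natDegree → toL (ρ (.of F _ (QuaternionGroup.a 1))) = conjBy (gammaZ ι (β j)) (diagInv (β j)) ∧
        toL (ρ (.of F _ (QuaternionGroup.xa 0))) = conjBy (gammaZ ι (β j)) !![0, ι; ι, 0] ∧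
        ∀ w, toL (ρ (hatMap w)) =
          conjBy (gammaZ ι (β j)) (mapS (conjByInv (gammaZ ι (β j)) (toL (ρ w))))) ∧
      (∀ h4 : ¬ 4 ∣ (g j).natDegree,
        (∃ h : diagInv (β j) ∈ (θ j j.2 h4).S, ρ (.of F _ (QuaternionGroup.a 1)) = (θ j j.2 h4).iso ⟨_, h⟩) ∧
        (∃ h : !![0, ι; ι, 0] ∈ (θ j j.2 h4).S, ρ (.of F _ (QuaternionGroup.xa 0)) = (θ j j.2 h4).iso ⟨_, h⟩) ∧
        ∀ w, ∃ h : mapS ((θ j j.2 h4).iso.symm (ρ w) : Mat2 L) ∈ (θ j j.2 h4).S,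
          ρ (hatMap w) = (θ j j.2 h4).iso ⟨_, h⟩) ∧
      ∀ w, ρ w = 0 → PartsVanish (β j : L) w := by
    by_cases h4 : 4 ∣ (g j).natDegree
    · obtain ⟨ρ, h1, h2, h3, h5⟩ := exists_gamma_block (F := F) hι (hβn j (mid j.2))
        (hβne j j.2) (by
          rw [mem_iff_pow_card_pow_finrank, iota_pow_card_pow hι hq, hhalf j j.2,
            Even.neg_one_pow (by rw [Nat.even_iff]; omega), one_mul])
      exact ⟨ρ, fun _ => ⟨h1, h2, h3⟩, fun h => absurd h4 h, h5⟩
    · have := IntermediateField.adjoin.finiteDimensional (hβint j (mid j.2))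
      obtain ⟨ρ, h1, h2, h3, h5⟩ := exists_theta_block (F := F) hι (hβn j (mid j.2))
        (by
          rw [mem_iff_pow_card_pow_finrank, iota_pow_card_pow hι hq, ← hβdeg j (mid j.2),
            hβdeg2 j j.2, pow_mul]
          simp)
        (by rw [iota_pow_card_pow hι hq, (hodd j j.2 h4).neg_one_pow, neg_one_mul])
        (by
          rw [← hhalf j j.2]
          exact frobenius_eq_inv (hβint j (mid j.2)) (hβinv j j.2) (hβne j j.2)
            (hβ0 j (mid j.2)))
        (θ j j.2 h4)
      exact ⟨ρ, fun h => absurd h h4, fun _ => ⟨h1, h2, h3⟩, h5⟩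
  choose ρB hBγ hBθ hBv using hB
  choose ρB' hB'a hB'b hB'hat hB'v using fun j : Set.Icc (t + 1) (t + k) =>
    exists_rest_block_mapS (F := F) (hβn j (last j.2))
  -- the isomorphism `ψ`
  let ψ₀ : MonoidAlgebra F (QuaternionGroup n) →ₐ[F] BlocksA F α r s × BlocksB F ι β t k :=
    (ρA₁.prod ((AlgHom.pi ρA).prod (AlgHom.pi ρA'))).prod
      (ρB₁.prod ((AlgHom.pi ρB).prod (AlgHom.pi ρB')))
  have hψ₀ (w) : ψ₀ w = ((ρA₁ w, fun i => ρA i w, fun i => ρA' i w),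
      (ρB₁ w, fun j => ρB j w, fun j => ρB' j w)) := rfl
  have hinj : Function.Injective ψ₀ := by
    rw [injective_iff_map_eq_zero]
    intro w hw
    rw [hψ₀] at hw
    simp only [Prod.mk_eq_zero, funext_iff, Pi.zero_apply] at hw
    obtain ⟨⟨hw1, hw2, hw3⟩, hw4, hw5, hw6⟩ := hw
    have hα1 : α 1 = 1 := by
      have := hα 1 (Finset.mem_Icc.2 ⟨le_rfl, hf.one_le.trans (by omega)⟩)
      rw [hf.first] at this
      simpa [sub_eq_zero] using this
    have hβ1 : β 1 = -1 := by
      have := hβ 1 (Finset.mem_Icc.2 ⟨le_rfl, hg.one_le.trans (by omega)⟩)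
      rw [hg.first] at this
      simpa [add_eq_zero_iff_eq_neg] using this
    have ev (c : F) (p : F[X]) (hp : eval c p = 0) : aeval (algebraMap F L c) p = 0 := by
      rw [aeval_algebraMap_apply_eq_algebraMap_eval, hp, map_zero]
    have hvA (i) (hi : i ∈ Finset.Icc 1 (r + s)) : PartsVanish (α i) w := by
      have hi' := Finset.mem_Icc.1 hi
      obtain rfl | h | h : i = 1 ∨ (2 ≤ i ∧ i ≤ r) ∨ (r + 1 ≤ i ∧ i ≤ r + s) := by omega
      · obtain ⟨h1, h2⟩ := hA₁v w hw1
        have h1 := ev _ _ h1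
        have h2 := ev _ _ h2
        rw [map_one] at h1 h2
        rw [hα1, PartsVanish, inv_one]
        exact ⟨⟨h1, h1⟩, h2, h2⟩
      · exact hAv ⟨i, h⟩ w (hw2 _)
      · exact hA'v ⟨i, h⟩ w (hw3 _)
    have hvB (j) (hj : j ∈ Finset.Icc 1 (t + k)) : PartsVanish (β j) w := by
      have hj' := Finset.mem_Icc.1 hj
      obtain rfl | h | h : j = 1 ∨ (2 ≤ j ∧ j ≤ t) ∨ (t + 1 ≤ j ∧ j ≤ t + k) := by omega
      · obtain ⟨h1, h2⟩ := hB₁v w hw4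
        have h1 := ev _ _ h1
        have h2 := ev _ _ h2
        rw [map_neg, map_one] at h1 h2
        rw [hβ1, PartsVanish, inv_neg, inv_one]
        exact ⟨⟨h1, h1⟩, h2, h2⟩
      · exact hBv ⟨j, h⟩ w (hw5 _)
      · exact hB'v ⟨j, h⟩ w (hw6 _)
    apply QuaternionGroup.eq_zero_of_parts_eq_zero
    · exact eq_zero_of_forall_aeval_eq_zero h2n (QuaternionGroup.degree_aPart_lt w)
        (fun z hz => hf.aeval_eq_zero_of_forall_root h0f hα (fun i hi => (hvA i hi).1) hz)
        (fun z hz => hg.aeval_eq_zero_of_forall_root h0g hβ (fun j hj => (hvB j hj).1) hz)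
    · exact eq_zero_of_forall_aeval_eq_zero h2n (QuaternionGroup.degree_xaPart_lt w)
        (fun z hz => hf.aeval_eq_zero_of_forall_root h0f hα (fun i hi => (hvA i hi).2) hz)
        (fun z hz => hg.aeval_eq_zero_of_forall_root h0g hβ (fun j hj => (hvB j hj).2) hz)
  have hbij : Function.Bijective ψ₀ := by
    obtain ⟨hAfin, hAle⟩ := hf'.finrank_blocks h0f (F × F) (by simp)
      (fun i : Set.Icc 2 r => F⟮α i + (α i)⁻¹⟯) (fun i => hαdeg2 i i.2)
      (fun i : Set.Icc (r + 1) (r + s) => F⟮α i⟯) (fun i => hαdeg i (last i.2))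
    obtain ⟨hBfin, hBle⟩ := hg'.finrank_blocks h0g F⟮ι⟯ hιdeg
      (fun j : Set.Icc 2 t => F⟮β j + (β j)⁻¹⟯) (fun j => hβdeg2 j j.2)
      (fun j : Set.Icc (t + 1) (t + k) => F⟮β j⟯) (fun j => hβdeg j (last j.2))
    rw [show (X ^ n - 1 : F[X]).natDegree = n from natDegree_X_pow_sub_C (r := (1 : F))] at hAle
    rw [show (X ^ n + 1 : F[X]).natDegree = n from natDegree_X_pow_add_C (r := (1 : F))] at hBle
    exact bijective_of_injective_of_finrank_le ψ₀ hinj hAfin hBfin hAle hBle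
  let ψ := AlgEquiv.ofBijective ψ₀ hbij
  refine ⟨ψ, ⟨⟨hA₁a, hAa, hA'a⟩, ⟨hA₁b, hAb, hA'b⟩,
    ⟨hB₁a, fun j h4 => (hBγ j h4).1, fun j h4 => (hBθ j h4).1, hB'a⟩,
    ⟨hB₁b, fun j h4 => (hBγ j h4).2.1, fun j h4 => (hBθ j h4).2.1, hB'b⟩⟩,
    -- `ν` is the transported hat map, so the intertwining is immediate; the content is that it
    -- satisfies the block formulas, checked at `x = ψ w`.
    fun x => ψ (hatMap (ψ.symm x)), fun x => ?_, fun w => by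
      dsimp only; rw [AlgEquiv.symm_apply_apply]⟩
  obtain ⟨w, rfl⟩ := ψ.surjective x
  dsimp only
  rw [AlgEquiv.symm_apply_apply]
  exact ⟨⟨hA₁hat w, fun i => hAhat i w, fun i => hA'hat i w⟩,
    ⟨hB₁hat w, fun j h4 => (hBγ j h4).2.2 w, fun j h4 => (hBθ j h4).2.2 w, fun j => hB'hat j w⟩⟩
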